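/- A numerical semigroup is an additive submonoid $S\subseteq\mathbb N$ with $\mathbb N\setminus S$ finite. Write $F(S)=\max(\mathbb Z\setminus S)$ for its Frobenius number, $g(S)=|\mathbb N\setminus S|$, $\mathrm{PF}(S)=\{f\in\mathbb Z\setminus S : f+s\in S \text{ for all } s\in S\setminus\{0\}\}$, and let the type of $S$ be $t(S)=|\mathrm{PF}(S)|$. The semigroup $S$ is almost symmetric if $2g(S)=F(S)+t(S)$. It is 4-generated if its unique minimal system of generators has exactly four elements. For odd integers $\alpha_1,\alpha_2,\alpha_3,\alpha_4>1$ put $$\begin{aligned} n_1&=(\alpha_2-1)(\alpha_3-1)\alpha_4+\alpha_2, & n_2&=(\alpha_3-1)(\alpha_4-1)\alpha_1+\alpha_3,\\ n_3&=(\alpha_4-1)(\alpha_1-1)\alpha_2+\alpha_4, & n_4&=(\alpha_1-1)(\alpha_2-1)\alpha_3+\alpha_1. \end{aligned}$$ **Theorem.** (1) If $\alpha_1,\dots,\alpha_4>1$ are odd and $\gcd(n_1,n_2,n_3,n_4)=1$, then $S=\langle n_1,n_2,n_3,n_4\rangle$ is an almost symmetric numerical semigroup of type three, the integers $n_1,\dots,n_4$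 are odd, and they form the minimal system of generators of $S$. (2) Conversely, let $S$ be a 4-generated almost symmetric numerical semigroup of type three whose minimal generators are all odd. Then there are odd integers $\alpha_1,\dots,\alpha_4>1$ such that the associated $n_1,\dots,n_4$ satisfy $\gcd(n_1,n_2,n_3,n_4)=1$ and are, in a suitable order, the minimal generators of $S$. -/

import Mathlib

/-- A numerical semigroup: an additive submonoid of `ℕ` with finite complement. -/
def IsNumericalSemigroup (S : AddSubmonoid ℕ) : Prop :=
  ((S : Set ℕ)ᶜ).Finite

/-- The elements of `S`, viewed as integers. -/
def intElements (S : AddSubmonoid ℕ) : Set ℤ :=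
  (fun s : ℕ => (s : ℤ)) '' (S : Set ℕ)

/-- The Frobenius number `F(S)`, i.e. the maximum of `ℤ \ S`
(the maximum exists by `isGreatest_frobeniusInt`; for instance `F(ℕ) = -1`). -/
noncomputable def frobeniusInt (S : AddSubmonoid ℕ) : ℤ :=
  sSup (intElements S)ᶜ

/-- The supremum in the definition of `F(S)` is a maximum. -/
theorem isGreatest_frobeniusInt (S : AddSubmonoid ℕ) (hS : IsNumericalSemigroup S) :
    IsGreatest (intElements S)ᶜ (frobeniusInt S) := by
  have hne : ((intElements S)ᶜ).Nonempty := by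
    refine ⟨-1, ?_⟩
    rintro ⟨s, -, hs⟩
    have : (s : ℤ) = -1 := hs
    omega
  have hbd : BddAbove (intElements S)ᶜ := by
    obtain ⟨b, hb⟩ := Set.Finite.bddAbove hS
    refine ⟨b, fun z hz => ?_⟩
    rcases lt_or_ge z 0 with h | h
    · omega
    · obtain ⟨k, rfl⟩ := Int.eq_ofNat_of_zero_le h
      have hk : k ∈ ((S : Set ℕ)ᶜ) := fun hk => hz ⟨k, hk, rfl⟩
      exact_mod_cast hb hk
  exact ⟨Int.csSup_mem hne hbd, fun z hz => le_csSup hbd hz⟩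

/-- The set `PF(S)` of pseudo-Frobenius numbers: integers `f ∉ S` such that `f + s ∈ S` for
every nonzero `s ∈ S`. -/
def pseudoFrobenius (S : AddSubmonoid ℕ) : Set ℤ :=
  {f : ℤ | f ∉ intElements S ∧ ∀ s ∈ S, s ≠ 0 → f + (s : ℤ) ∈ intElements S}

/-- The type `t(S)`, the number of pseudo-Frobenius numbers. -/
noncomputable def semigroupType (S : AddSubmonoid ℕ) : ℕ :=
  (pseudoFrobenius S).ncard

/-- The genus `g(S)`, the number of gaps `|ℕ \ S|`. -/
noncomputable def genus (S : AddSubmonoid ℕ) : ℕ :=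
  ((S : Set ℕ)ᶜ).ncard

/-- A numerical semigroup is almost symmetric if `2 g(S) = F(S) + t(S)`. -/
def IsAlmostSymmetric (S : AddSubmonoid ℕ) : Prop :=
  IsNumericalSemigroup S ∧ 2 * (genus S : ℤ) = frobeniusInt S + (semigroupType S : ℤ)

/-- `n₁, …, n_e` is the minimal system of generators of `S` (in some order): it generates `S`, and
no `n_i` lies in the submonoid generated by the others. In particular the `n_i` are pairwise
distinct and positive, and `e` is the embedding dimension of `S`. -/
def IsMinimalSystemOfGenerators {e : ℕ} (n : Fin e → ℕ) (S : AddSubmonoid ℕ) : Prop :=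
  AddSubmonoid.closure (Set.range n) = S ∧
    ∀ i : Fin e, n i ∉ AddSubmonoid.closure (n '' {j | j ≠ i})

/-- The numbers `n₁, …, n₄` attached to `α₁, …, α₄` (indexed from `0` to `3` here; the natural
subtractions are genuine whenever every `α i` is positive). -/
def gens (α : Fin 4 → ℕ) : Fin 4 → ℕ :=
  ![(α 1 - 1) * (α 2 - 1) * α 3 + α 1,
    (α 2 - 1) * (α 3 - 1) * α 0 + α 2,
    (α 3 - 1) * (α 0 - 1) * α 1 + α 3,
    (α 0 - 1) * (α 1 - 1) * α 2 + α 0]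

/-! Write `a i = α i - 1`. The numbers `gens α` satisfy the cyclic relations `f + n i = a (i + 1) *
n (i + 1)` with `f = a 0 * a 1 * a 2 * a 3 - 1`; both directions rest on these relations.

From the relations to the semigroup: in any abelian group, every element of the subgroup generated
by the `e i` is a representative from an explicit list plus a multiple of `e 0`. This yields the
duality `CyclicRelations.mem_or_sub_mem`: for each `x`, either `x` or `3f - x` lies in the monoid,
or `x` is `f` or `2f`. If the gcd is one, the cyclic relations generate all relations among the `n
i`, and a sign argument keeps `f`, `2f`, `3f` outside `S`. Hence `F(S) = 3f`, the only failures of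
symmetry are `f` and `2f`, and `PF(S) = {f, 2f, 3f}`.

From the semigroup to the relations: almost symmetry and type three give `PF(S) = {u, v, u + v}`
with `u + v = F(S)` odd, and `u`, `v` are the only failures of symmetry. Draw an arrow `i → j` when
some factorization of `u + n i` uses `n j`. Since all generators are odd, the arrows of `v` are
exactly the reversed non-arrows of `u` (`DualPair.arrow_iff`). A row with one arrow reads `u + n i =
a * n j`, and no `t * n j` with `1 ≤ t ≤ a` is a combination of the other generators (`Capped`).
With parity this excludes enough local configurations that a finite check leaves eight digraphs
(`digraph_classification`). Taking `u` odd, seven are contradictory; the last is a four-cycle for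
`u`, which gives the cyclic relations with even coefficients and forces `v = 2u`.

Finally `f, 2f ∉ S` makes the cyclic relations generate all relations: apply the duality in `ℤ⁴`
modulo the cyclic relations. The generators are then determined up to a common factor, which the gcd
makes one (`CyclicRelations.eq_standard`). -/

/-! ### Cyclic relations in an abelian group and their duality -/

/-- Elements `e i` of an abelian group linked cyclically by an element `f`:
`f + e i = a (i + 1) • e (i + 1)`. -/
structure CyclicRelations {G : Type*} [AddCommGroup G] (a : Fin 4 → ℤ) (e : Fin 4 → G) (f : G) :
    Prop where
  pos : ∀ i, 1 ≤ a i
  rel0 : f + e 0 = a 1 • e 1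
  rel1 : f + e 1 = a 2 • e 2
  rel2 : f + e 2 = a 3 • e 3
  rel3 : f + e 3 = a 0 • e 0

namespace CyclicRelations

variable {G : Type*} [AddCommGroup G] {a : Fin 4 → ℤ} {e : Fin 4 → G} {f : G}

/-- Candidates for the elements of the Apéry set with respect to `e 0`. -/
def Apery (a : Fin 4 → ℤ) (e : Fin 4 → G) (y : G) : Prop :=
  (∃ j k l : ℤ, 0 ≤ j ∧ j < a 1 ∧ 0 ≤ k ∧ k < a 2 ∧ 0 ≤ l ∧ l ≤ a 3 ∧
    y = j • e 1 + k • e 2 + l • e 3) ∨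
  y = a 1 • e 1 ∨
  ∃ j : ℤ, 0 ≤ j ∧ j < a 1 ∧ y = j • e 1 + a 2 • e 2

/-- When the coefficient of `e 1` reaches `a 1`, the identity `a 1 • e 1 = f + e 0` produces an `f`,
which is absorbed by an available `e 3`, `e 2` or `e 1` through the next relation. The list has `a 1
* a 2 * (a 3 + 1) + 1 + a 1` expressions, the value of the standard first generator. -/
theorem apery_add (h : CyclicRelations a e f) {y : G} (hy : Apery a e y) :
    ∃ z, Apery a e z ∧ ∃ k : ℤ, y + e 1 = z + k • e 0 := by
  have h0 := h.rel0
  have h1 := h.rel1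
  have h2 := h.rel2
  have h3 := h.rel3
  have p1 := h.pos 1
  have p2 := h.pos 2
  have p3 := h.pos 3
  rcases hy with ⟨j, k, l, j0, j1, k0, k1, l0, l1, rfl⟩ | rfl | ⟨j, j0, j1, rfl⟩
  · rcases lt_or_ge (j + 1) (a 1) with hj | hj
    · exact ⟨_, Or.inl ⟨j + 1, k, l, by omega, hj, k0, k1, l0, l1, rfl⟩, 0, by module⟩
    obtain rfl : j = a 1 - 1 := by omega
    rcases k0.eq_or_lt with rfl | hk
    · rcases l0.eq_or_lt with rfl | hl
      · exact ⟨_, Or.inr (Or.inl rfl), 0, by module⟩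
      · refine ⟨_, Or.inl ⟨0, 0, l - 1, le_rfl, by omega, le_rfl, by omega, by omega, by omega,
          rfl⟩, a 0 + 1, ?_⟩
        linear_combination (norm := module) h3 - h0
    · rcases l0.eq_or_lt with rfl | hl
      · refine ⟨_, Or.inl ⟨0, k - 1, a 3, le_rfl, by omega, by omega, by omega, by omega, le_rfl,
          rfl⟩, 1, ?_⟩
        linear_combination (norm := module) h2 - h0
      · refine ⟨_, Or.inl ⟨0, k, l - 1, le_rfl, by omega, by omega, by omega, by omega, by omega,
          rfl⟩, a 0 + 1, ?_⟩
        linear_combination (norm := module) h3 - h0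
  · exact ⟨_, Or.inr (Or.inr ⟨0, le_rfl, by omega, rfl⟩), 1, by
      linear_combination (norm := module) h1 - h0⟩
  · rcases lt_or_ge (j + 1) (a 1) with hj | hj
    · exact ⟨_, Or.inr (Or.inr ⟨j + 1, by omega, hj, rfl⟩), 0, by module⟩
    obtain rfl : j = a 1 - 1 := by omega
    refine ⟨_, Or.inl ⟨0, a 2 - 1, a 3, le_rfl, by omega, by omega, by omega, by omega, le_rfl,
      rfl⟩, 1, ?_⟩
    linear_combination (norm := module) h2 - h0

theorem exists_apery_nsmul (h : CyclicRelations a e f) (m : ℕ) :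
    ∃ z, Apery a e z ∧ ∃ k : ℤ, (m : ℤ) • e 1 = z + k • e 0 := by
  induction m with
  | zero =>
    refine ⟨_, Or.inl ⟨0, 0, 0, le_rfl, h.pos 1, le_rfl, h.pos 2, le_rfl, ?_, rfl⟩, 0, by simp⟩
    have := h.pos 3
    omega
  | succ m ih =>
    obtain ⟨z, hz, k, hk⟩ := ih
    obtain ⟨w, hw, l, hl⟩ := h.apery_add hz
    refine ⟨w, hw, l + k, ?_⟩
    push_cast
    linear_combination (norm := module) hk + hl

/-- Gives `e 1` finite order modulo `e 0`, so negative multiples of `e 1` can be traded for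
nonnegative ones. -/
theorem order_relation (h : CyclicRelations a e f) :
    (a 1 * a 2 * (a 3 + 1) + a 1 + 1) • e 1 = (a 2 * a 3 * (a 0 + 1) + a 2 + 1) • e 0 := by
  linear_combination (norm := module) (-(a 2 * a 3 + a 2 + 1)) • h.rel0 + h.rel1 + a 2 • h.rel2 +
    (a 2 * a 3) • h.rel3

theorem exists_apery (h : CyclicRelations a e f) {x : G}
    (hx : x ∈ AddSubgroup.closure (Set.range e)) :
    ∃ z, Apery a e z ∧ ∃ k : ℤ, x = z + k • e 0 := by
  have key : ∃ p q : ℤ, x = p • e 0 + q • e 1 := by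
    induction hx using AddSubgroup.closure_induction with
    | mem x hx =>
      obtain ⟨i, rfl⟩ := hx
      fin_cases i
      · exact ⟨1, 0, by simp⟩
      · exact ⟨0, 1, by simp⟩
      · refine ⟨a 3 * (a 0 + 1) + 1, -a 1 - a 3 * a 1, ?_⟩
        simp only [Fin.reduceFinMk]
        linear_combination (norm := module) h.rel2 + a 3 • h.rel3 - (a 3 + 1) • h.rel0
      · refine ⟨a 0 + 1, -a 1, ?_⟩
        simp only [Fin.reduceFinMk]
        linear_combination (norm := module) h.rel3 - h.rel0
    | zero => exact ⟨0, 0, by simp⟩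
    | add x y _ _ ihx ihy =>
      obtain ⟨p, q, rfl⟩ := ihx
      obtain ⟨r, s, rfl⟩ := ihy
      exact ⟨p + r, q + s, by module⟩
    | neg x _ ih =>
      obtain ⟨p, q, rfl⟩ := ih
      exact ⟨-p, -q, by module⟩
  obtain ⟨p, q, rfl⟩ := key
  have p1 := h.pos 1
  have p2 := h.pos 2
  have p3 := h.pos 3
  set N := a 1 * a 2 * (a 3 + 1) + a 1 + 1 with hN
  have N1 : 1 ≤ N := by
    have : 0 ≤ a 1 * a 2 * (a 3 + 1) := by positivity
    omega
  -- Adding the order relation `|q|` times makes the coefficient of `e 1` nonnegative without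
  -- changing the class modulo `e 0`.
  have hq : 0 ≤ q + |q| * N := by nlinarith [neg_abs_le q, abs_nonneg q]
  obtain ⟨m, hm⟩ := Int.eq_ofNat_of_zero_le hq
  obtain ⟨z, hz, k, hk⟩ := h.exists_apery_nsmul m
  rw [← hm] at hk
  refine ⟨z, hz, k + p - |q| * (a 2 * a 3 * (a 0 + 1) + a 2 + 1), ?_⟩
  linear_combination (norm := module) hk - |q| • h.order_relation

/-- The duality of the submonoid generated by cyclically linked elements. -/
theorem mem_or_sub_mem (h : CyclicRelations a e f) {M : AddSubmonoid G} (hM : ∀ i, e i ∈ M) {x : G}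
    (hx : x ∈ AddSubgroup.closure (Set.range e)) :
    x ∈ M ∨ (3 : ℤ) • f - x ∈ M ∨ x = f ∨ x = (2 : ℤ) • f := by
  have hmul : ∀ (i : Fin 4) (k : ℤ), 0 ≤ k → k • e i ∈ M := by
    intro i k hk
    obtain ⟨m, rfl⟩ := Int.eq_ofNat_of_zero_le hk
    rw [natCast_zsmul]
    exact nsmul_mem (hM i) m
  have h0 := h.rel0
  have h1 := h.rel1
  have h2 := h.rel2
  have p1 := h.pos 1
  have p2 := h.pos 2
  have p3 := h.pos 3
  obtain ⟨z, hz, k, rfl⟩ := h.exists_apery hx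
  rcases lt_or_ge k 0 with hk | hk
  · right
    rcases hz with ⟨i, j, l, i0, i1, j0, j1, l0, l1, rfl⟩ | rfl | ⟨j, j0, j1, rfl⟩
    · left
      -- The first three relations add up to `3f = (a 1 - 1) e 1 + (a 2 - 1) e 2 + a 3 e 3 - e 0`,
      -- so subtraction from `3f` complements the box of exponents and turns `k` into `-k - 1`.
      have : (3 : ℤ) • f - (i • e 1 + j • e 2 + l • e 3 + k • e 0) =
          (a 1 - 1 - i) • e 1 + (a 2 - 1 - j) • e 2 + (a 3 - l) • e 3 + (-k - 1) • e 0 := by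
        linear_combination (norm := module) h0 + h1 + h2
      rw [this]
      exact add_mem (add_mem (add_mem (hmul _ _ (by omega)) (hmul _ _ (by omega)))
        (hmul _ _ (by omega))) (hmul _ _ (by omega))
    -- On the two families outside the box only `k = -1` can fail, and it does so at `f = a 1 e 1 -
    -- e 0` and `2f = (a 1 - 1) e 1 + a 2 e 2 - e 0`.
    · rcases (show k = -1 ∨ k ≤ -2 by omega) with rfl | hk'
      · right; left
        linear_combination (norm := module) -h0
      · left
        have : (3 : ℤ) • f - (a 1 • e 1 + k • e 0) =
            (a 1 - 1) • e 1 + a 2 • e 2 + (-k - 2) • e 0 := by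
          linear_combination (norm := module) (2 : ℤ) • h0 + h1
        rw [this]
        exact add_mem (add_mem (hmul _ _ (by omega)) (hmul _ _ (by omega))) (hmul _ _ (by omega))
    · rcases (show j = a 1 - 1 ∨ j < a 1 - 1 by omega) with rfl | hj
      · rcases (show k = -1 ∨ k ≤ -2 by omega) with rfl | hk'
        · right; right
          linear_combination (norm := module) -h0 - h1
        · left
          have : (3 : ℤ) • f - ((a 1 - 1) • e 1 + a 2 • e 2 + k • e 0) =
              a 1 • e 1 + (-k - 2) • e 0 := by
            linear_combination (norm := module) (2 : ℤ) • h0 + h1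
          rw [this]
          exact add_mem (hmul _ _ (by omega)) (hmul _ _ (by omega))
      · left
        have : (3 : ℤ) • f - (j • e 1 + a 2 • e 2 + k • e 0) =
            (a 1 - 2 - j) • e 1 + a 2 • e 2 + (-k - 1) • e 0 := by
          linear_combination (norm := module) h0 + (2 : ℤ) • h1
        rw [this]
        exact add_mem (add_mem (hmul _ _ (by omega)) (hmul _ _ (by omega))) (hmul _ _ (by omega))
  · left
    refine add_mem ?_ (hmul 0 k hk)
    rcases hz with ⟨j, k, l, j0, j1, k0, k1, l0, l1, rfl⟩ | rfl | ⟨j, j0, j1, rfl⟩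
    · exact add_mem (add_mem (hmul _ _ j0) (hmul _ _ k0)) (hmul _ _ l0)
    · exact hmul _ _ (by omega)
    · exact add_mem (hmul _ _ j0) (hmul _ _ (by omega))

end CyclicRelations

/-! ### The relation lattice of the standard numbers -/

namespace CyclicRelations

variable {a n : Fin 4 → ℤ} {f : ℤ}

/-- The integer relations which follow from the cyclic ones. -/
def IsConsequence (a x : Fin 4 → ℤ) : Prop :=
  ∃ c : Fin 4 → ℤ, c 0 + c 1 + c 2 + c 3 = 0 ∧ x 0 = c 0 - a 0 * c 3 ∧ x 1 = c 1 - a 1 * c 0 ∧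
    x 2 = c 2 - a 2 * c 1 ∧ x 3 = c 3 - a 3 * c 2

/-- The relation lattice of the cyclic numbers themselves, if these have greatest common
divisor one. -/
theorem isConsequence_of_sum_eq_zero (h : CyclicRelations a n f)
    (h0 : n 0 = a 1 * a 2 * (a 3 + 1) + a 1 + 1) (h1 : n 1 = a 2 * a 3 * (a 0 + 1) + a 2 + 1)
    (hgcd : ∀ d : ℤ, (∀ i, d ∣ n i) → IsUnit d) {x : Fin 4 → ℤ}
    (hx : x 0 * n 0 + x 1 * n 1 + x 2 * n 2 + x 3 * n 3 = 0) : IsConsequence a x := by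
  have r0 := h.rel0
  have r1 := h.rel1
  have r2 := h.rel2
  have r3 := h.rel3
  simp only [smul_eq_mul] at r0 r1 r2 r3
  have e3 : n 3 = (a 0 + 1) * n 0 - a 1 * n 1 := by linear_combination r3 - r0
  have e2 : n 2 = (a 3 * (a 0 + 1) + 1) * n 0 - (a 1 + a 3 * a 1) * n 1 := by
    linear_combination r2 + a 3 * r3 - (a 3 + 1) * r0
  have hcop : IsCoprime (n 0) (n 1) := by
    rw [← isRelPrime_iff_isCoprime]
    intro d hd0 hd1
    refine hgcd d fun i => ?_
    fin_cases i
    · exact hd0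
    · exact hd1
    · change d ∣ n 2
      rw [e2]
      exact dvd_sub (hd0.mul_left _) (hd1.mul_left _)
    · change d ∣ n 3
      rw [e3]
      exact dvd_sub (hd0.mul_left _) (hd1.mul_left _)
  have hn0 : n 0 ≠ 0 := by
    have p1 := h.pos 1
    have p2 := h.pos 2
    have p3 := h.pos 3
    have : 0 ≤ a 1 * a 2 * (a 3 + 1) := by positivity
    omega
  -- Eliminating `n 2` and `n 3` leaves a relation between the coprime numbers `n 0` and `n 1`,
  -- hence a multiple `t` of the trivial one.
  have hpq : (x 0 + x 2 * (a 3 * (a 0 + 1) + 1) + x 3 * (a 0 + 1)) * n 0 +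
      (x 1 - x 2 * (a 1 + a 3 * a 1) - x 3 * a 1) * n 1 = 0 := by
    rw [e2, e3] at hx
    linear_combination hx
  obtain ⟨t, ht⟩ : n 0 ∣ x 1 - x 2 * (a 1 + a 3 * a 1) - x 3 * a 1 := by
    refine hcop.dvd_of_dvd_mul_right
      ⟨-(x 0 + x 2 * (a 3 * (a 0 + 1) + 1) + x 3 * (a 0 + 1)), ?_⟩
    linear_combination hpq
  have hp : x 0 + x 2 * (a 3 * (a 0 + 1) + 1) + x 3 * (a 0 + 1) = -(n 1 * t) := by
    rw [ht] at hpq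
    refine mul_right_cancel₀ hn0 ?_
    linear_combination hpq
  -- The free parameter is `c 1 = t`; then `x 2` and `x 3` determine `c 2` and `c 3`, and the zero
  -- sum determines `c 0`.
  refine ⟨![-(x 2 * (a 3 + 1)) - x 3 - t * (a 2 * a 3 + a 2 + 1), t, x 2 + t * a 2,
    x 2 * a 3 + x 3 + t * (a 2 * a 3)], ?_, ?_, ?_, ?_, ?_⟩ <;> simp
  · ring
  · linear_combination hp - t * h1
  · linear_combination ht + t * h0
  · ring
  · ring

/-- The first three multiples of `f` are not combinations of the cyclic numbers. -/
theorem not_mul_eq_sum (h : CyclicRelations a n f)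
    (h0 : n 0 = a 1 * a 2 * (a 3 + 1) + a 1 + 1) (h1 : n 1 = a 2 * a 3 * (a 0 + 1) + a 2 + 1)
    (hgcd : ∀ d : ℤ, (∀ i, d ∣ n i) → IsUnit d) {m : ℤ} (m0 : 0 < m) (m3 : m ≤ 3)
    {x : Fin 4 → ℤ} (hx : ∀ i, 0 ≤ x i) :
    m * f ≠ x 0 * n 0 + x 1 * n 1 + x 2 * n 2 + x 3 * n 3 := by
  intro hf
  have r0 := h.rel0
  simp only [smul_eq_mul] at r0
  -- The relation is the assumed equation with `m * f` rewritten as `m * (a 1 * n 1 - n 0)`.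
  obtain ⟨c, hc, c0, c1, c2, c3⟩ := h.isConsequence_of_sum_eq_zero h0 h1 hgcd
    (x := ![x 0 + m, x 1 - m * a 1, x 2, x 3]) (by simp; linear_combination -hf + m * r0)
  simp at c0 c1 c2 c3
  have p0 := h.pos 0
  have p1 := h.pos 1
  have p2 := h.pos 2
  have p3 := h.pos 3
  have x0 := hx 0
  have x1 := hx 1
  have x2 := hx 2
  have x3 := hx 3
  have d0 : a 0 * c 3 ≤ c 0 - m := by linarith
  have d1 : a 1 * (c 0 - m) ≤ c 1 := by linarith
  have d2 : a 2 * c 1 ≤ c 2 := by linarith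
  have d3 : a 3 * c 2 ≤ c 3 := by linarith
  have n0 : c 0 - m < 0 := by
    by_contra! hn
    have := (mul_nonneg (by omega) hn).trans d1
    have := (mul_nonneg (by omega) this).trans d2
    have := (mul_nonneg (by omega) this).trans d3
    omega
  have n3 : c 3 < 0 := by
    by_contra! hn
    have := (mul_nonneg (by omega) hn).trans d0
    omega
  have n2 : c 2 < 0 := by
    by_contra! hn
    have := (mul_nonneg (by omega) hn).trans d3
    omega
  have n1 : c 1 < 0 := by
    by_contra! hn
    have := (mul_nonneg (by omega) hn).trans d2
    omega
  -- The four negative integers `c 0 - m`, `c 1`, `c 2`, `c 3` sum to at most `-4`, but their sum is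
  -- `-m ≥ -3`.
  omega

/-- The first cyclic number is not a combination of the others. -/
theorem zero_ne_sum (h : CyclicRelations a n f)
    (h0 : n 0 = a 1 * a 2 * (a 3 + 1) + a 1 + 1) (h1 : n 1 = a 2 * a 3 * (a 0 + 1) + a 2 + 1)
    (hgcd : ∀ d : ℤ, (∀ i, d ∣ n i) → IsUnit d) {x : Fin 4 → ℤ} (hx : ∀ i, 0 ≤ x i) :
    n 0 ≠ x 1 * n 1 + x 2 * n 2 + x 3 * n 3 := by
  intro hf
  obtain ⟨c, hc, c0, c1, c2, c3⟩ := h.isConsequence_of_sum_eq_zero h0 h1 hgcd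
    (x := ![-1, x 1, x 2, x 3]) (by simp; linear_combination -hf)
  simp at c0 c1 c2 c3
  have p0 := h.pos 0
  have p1 := h.pos 1
  have p2 := h.pos 2
  have p3 := h.pos 3
  have x1 := hx 1
  have x2 := hx 2
  have x3 := hx 3
  have d1 : a 1 * c 0 ≤ c 1 := by linarith
  have d2 : a 2 * c 1 ≤ c 2 := by linarith
  have d3 : a 3 * c 2 ≤ c 3 := by linarith
  have n0 : c 0 < 0 := by
    by_contra! hn
    have s1 := (mul_nonneg (by omega) hn).trans d1
    have s2 := (mul_nonneg (by omega) s1).trans d2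
    have s3 := (mul_nonneg (by omega) s2).trans d3
    have : c 3 = 0 := by omega
    rw [this] at c0
    omega
  have n3 : c 3 ≤ 0 := by
    by_contra! hn
    have := mul_pos (show 0 < a 0 by omega) hn
    omega
  have n2 : c 2 ≤ 0 := by
    by_contra! hn
    have := mul_pos (show 0 < a 3 by omega) hn
    omega
  have n1 : c 1 ≤ 0 := by
    by_contra! hn
    have := mul_pos (show 0 < a 2 by omega) hn
    omega
  omega

/-- If all relations are consequences of the cyclic ones, the numbers are determined up to a
multiple. -/
theorem dvd_of_isConsequence (hker : ∀ x : Fin 4 → ℤ,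
      x 0 * n 0 + x 1 * n 1 + x 2 * n 2 + x 3 * n 3 = 0 → IsConsequence a x) :
    a 1 * a 2 * (a 3 + 1) + a 1 + 1 ∣ n 0 := by
  -- For the trivial relation between `n 0` and `n 1`, the last two coordinates give `c 2 = a 2 * c
  -- 1` and `c 3 = a 3 * c 2`; the zero sum then makes `n 0` a multiple of `c 1`.
  obtain ⟨c, hc, c0, c1, c2, c3⟩ := hker ![-n 1, n 0, 0, 0] (by simp; ring)
  simp at c0 c1 c2 c3
  refine ⟨c 1, ?_⟩
  linear_combination c1 - a 1 * hc - a 1 * (a 3 + 1) * c2 - a 1 * c3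

/-- The numbers are proportional to the standard ones. -/
theorem mul_eq (h : CyclicRelations a n f) :
    (a 0 * a 1 * a 2 * a 3 - 1) * n 0 = f * (a 1 * a 2 * (a 3 + 1) + a 1 + 1) := by
  have r0 := h.rel0
  have r1 := h.rel1
  have r2 := h.rel2
  have r3 := h.rel3
  simp only [smul_eq_mul] at r0 r1 r2 r3
  linear_combination -r0 - a 1 * r1 - a 1 * a 2 * r2 - a 1 * a 2 * a 3 * r3

/-- Rotating the indices. -/
theorem rotate (h : CyclicRelations a n f) :
    CyclicRelations (fun i => a (i + 1)) (fun i => n (i + 1)) f where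
  pos _ := h.pos _
  rel0 := h.rel1
  rel1 := h.rel2
  rel2 := h.rel3
  rel3 := h.rel0

end CyclicRelations

/-! ### Completeness of the cyclic relations when `f` and `2 * f` are gaps -/

namespace CyclicRelations

variable {a n : Fin 4 → ℤ} {f : ℤ}

/-- The lattice generated by the cyclic relations. -/
def lattice (a : Fin 4 → ℤ) : AddSubgroup (Fin 4 → ℤ) where
  carrier := {x | IsConsequence a x}
  zero_mem' := ⟨0, by simp⟩
  add_mem' := by
    rintro x y ⟨c, hc, h0, h1, h2, h3⟩ ⟨d, hd, k0, k1, k2, k3⟩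
    refine ⟨c + d, ?_, ?_, ?_, ?_, ?_⟩ <;> simp only [Pi.add_apply]
    · linear_combination hc + hd
    · linear_combination h0 + k0
    · linear_combination h1 + k1
    · linear_combination h2 + k2
    · linear_combination h3 + k3
  neg_mem' := by
    rintro x ⟨c, hc, h0, h1, h2, h3⟩
    refine ⟨-c, ?_, ?_, ?_, ?_, ?_⟩ <;> simp only [Pi.neg_apply]
    · linear_combination -hc
    · linear_combination -h0
    · linear_combination -h1
    · linear_combination -h2
    · linear_combination -h3

/-- The value of an integer combination. -/
def value (n : Fin 4 → ℤ) : (Fin 4 → ℤ) →+ ℤ where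
  toFun x := x 0 * n 0 + x 1 * n 1 + x 2 * n 2 + x 3 * n 3
  map_zero' := by simp
  map_add' x y := by simp only [Pi.add_apply]; ring

theorem lattice_le_ker (h : CyclicRelations a n f) : lattice a ≤ (value n).ker := by
  rintro x ⟨c, hc, h0, h1, h2, h3⟩
  have r0 := h.rel0
  have r1 := h.rel1
  have r2 := h.rel2
  have r3 := h.rel3
  simp only [smul_eq_mul] at r0 r1 r2 r3
  change x 0 * n 0 + x 1 * n 1 + x 2 * n 2 + x 3 * n 3 = 0
  rw [h0, h1, h2, h3]
  linear_combination c 0 * r0 + c 1 * r1 + c 2 * r2 + c 3 * r3 - f * hc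

/-- If neither `f` nor `2 * f` is in the semigroup, then the cyclic relations generate all
relations. -/
theorem isConsequence_of_notMem (h : CyclicRelations a n f) {T : AddSubmonoid ℤ}
    (hT : ∀ i, n i ∈ T) (hf : f ∉ T) (hf2 : 2 * f ∉ T) {x : Fin 4 → ℤ}
    (hx : x 0 * n 0 + x 1 * n 1 + x 2 * n 2 + x 3 * n 3 = 0) : IsConsequence a x := by
  -- The duality is applied in `ℤ⁴` modulo the lattice, which cannot be presumed torsion-free. The
  -- vector `F` has value `f`, and so has `F + x` for every relation `x`; as neither `f` nor `2f =
  -- 3f - f` is in `T`, only an exceptional case is left, and it puts `x` into the lattice.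
  let φ : (Fin 4 → ℤ) ⧸ lattice a →+ ℤ := QuotientAddGroup.lift _ (value n) h.lattice_le_ker
  let e : Fin 4 → (Fin 4 → ℤ) ⧸ lattice a := fun i => QuotientAddGroup.mk (Pi.single i 1)
  let F : Fin 4 → ℤ := ![-1, a 1, 0, 0]
  let g : (Fin 4 → ℤ) ⧸ lattice a := QuotientAddGroup.mk F
  have hφ : ∀ y : Fin 4 → ℤ, φ (QuotientAddGroup.mk y) = value n y := fun y => rfl
  have hrel : ∀ {y z : Fin 4 → ℤ}, IsConsequence a (-y + z) →
      (QuotientAddGroup.mk y : (Fin 4 → ℤ) ⧸ lattice a) = QuotientAddGroup.mk z := by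
    intro y z hyz
    exact QuotientAddGroup.eq.2 hyz
  have hcons : ∀ c y : Fin 4 → ℤ, c 0 + c 1 + c 2 + c 3 = 0 → y 0 = c 0 - a 0 * c 3 →
      y 1 = c 1 - a 1 * c 0 → y 2 = c 2 - a 2 * c 1 → y 3 = c 3 - a 3 * c 2 →
      IsConsequence a y := fun c y h h0 h1 h2 h3 => ⟨c, h, h0, h1, h2, h3⟩
  have hcyc : CyclicRelations a e g := by
    refine ⟨h.pos, ?_, ?_, ?_, ?_⟩
    · refine hrel (hcons ![0, 0, 0, 0] _ ?_ ?_ ?_ ?_ ?_) <;>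
        simp [F, Matrix.vecHead, Matrix.vecTail]
    · refine hrel (hcons ![1, -1, 0, 0] _ ?_ ?_ ?_ ?_ ?_) <;>
        simp [F, Matrix.vecHead, Matrix.vecTail, sub_eq_add_neg]
    · refine hrel (hcons ![1, 0, -1, 0] _ ?_ ?_ ?_ ?_ ?_) <;>
        simp [F, Matrix.vecHead, Matrix.vecTail]
    · refine hrel (hcons ![1, 0, 0, -1] _ ?_ ?_ ?_ ?_ ?_) <;>
        simp [F, Matrix.vecHead, Matrix.vecTail]
  have hspan : ∀ y : Fin 4 → ℤ, (QuotientAddGroup.mk y : (Fin 4 → ℤ) ⧸ lattice a) ∈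
      AddSubgroup.closure (Set.range e) := by
    intro y
    have : (QuotientAddGroup.mk y : (Fin 4 → ℤ) ⧸ lattice a) = ∑ i, y i • e i := by
      have hy : y = ∑ i, y i • (Pi.single i 1 : Fin 4 → ℤ) := by
        ext j
        simp [Finset.sum_apply, Pi.single_apply]
      conv_lhs => rw [hy]
      simp only [e]
      exact map_sum (QuotientAddGroup.mk' (lattice a)) _ _
    rw [this]
    exact sum_mem fun i _ => zsmul_mem (AddSubgroup.subset_closure (Set.mem_range_self i)) _
  have hval : ∀ i, value n (Pi.single i 1) = n i := by
    intro i
    fin_cases i <;> simp [value]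
  have hvF : value n F = f := by
    have r0 := h.rel0
    simp only [smul_eq_mul] at r0
    simp [value, F]
    linear_combination -r0
  have hvx : value n x = 0 := hx
  have hmem := hcyc.mem_or_sub_mem (M := T.comap φ) (x := QuotientAddGroup.mk (F + x))
    (fun i => by
      change φ (e i) ∈ T
      rw [hφ, hval]
      exact hT i) (hspan _)
  have hg : φ g = f := by rw [hφ, hvF]
  have hgx : φ (QuotientAddGroup.mk (F + x)) = f := by
    rw [hφ, map_add, hvF, hvx, add_zero]
  simp only [AddSubmonoid.mem_comap, map_sub, map_zsmul, hgx, hg] at hmem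
  rcases hmem with hm | hm | hm | hm
  · exact absurd hm hf
  · refine absurd ?_ hf2
    convert hm using 1
    simp only [smul_eq_mul]
    ring
  · have h1 : IsConsequence a (-(F + x) + F) := QuotientAddGroup.eq.1 hm
    have h2 := (lattice a).neg_mem (x := -(F + x) + F) h1
    have : -(-(F + x) + F) = x := by abel
    rwa [this] at h2
  · exfalso
    have := congrArg φ hm
    rw [hgx, map_zsmul, hg, smul_eq_mul] at this
    have : f = 0 := by linarith
    exact hf (this ▸ T.zero_mem)

end CyclicRelations

/-! ### Counting gaps: genus, symmetry defect and pseudo-Frobenius numbers -/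

section Counting

theorem natCast_mem_intElements {S : AddSubmonoid ℕ} {s : ℕ} : (s : ℤ) ∈ intElements S ↔ s ∈ S := by
  constructor
  · rintro ⟨t, ht, hts⟩
    have : t = s := Nat.cast_injective (R := ℤ) hts
    exact this ▸ ht
  · exact fun hs => ⟨s, hs, rfl⟩

theorem nonneg_of_mem_intElements {S : AddSubmonoid ℕ} {x : ℤ} (hx : x ∈ intElements S) :
    0 ≤ x := by
  obtain ⟨t, -, rfl⟩ := hx
  exact Int.natCast_nonneg t

theorem zero_mem_intElements (S : AddSubmonoid ℕ) : (0 : ℤ) ∈ intElements S :=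
  ⟨0, S.zero_mem, rfl⟩

theorem add_mem_intElements {S : AddSubmonoid ℕ} {x y : ℤ} (hx : x ∈ intElements S)
    (hy : y ∈ intElements S) : x + y ∈ intElements S := by
  obtain ⟨s, hs, rfl⟩ := hx
  obtain ⟨t, ht, rfl⟩ := hy
  exact ⟨s + t, S.add_mem hs ht, by push_cast; rfl⟩

/-- The integers which violate symmetry. -/
def symmetryDefect (S : AddSubmonoid ℕ) : Set ℤ :=
  {x | x ∉ intElements S ∧ frobeniusInt S - x ∉ intElements S}

/-- The reflection `x ↦ F - x` of `[0, F]` sends elements of `S` to gaps; the gaps not reached are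
the symmetry defect. Almost symmetry therefore says that the defect has `t(S) - 1` elements, the
size of `PF(S) \ {F(S)}`. -/
theorem two_mul_genus {S : AddSubmonoid ℕ} (hS : IsNumericalSemigroup S) :
    (symmetryDefect S).Finite ∧
      2 * (genus S : ℤ) = frobeniusInt S + 1 + ((symmetryDefect S).ncard : ℤ) := by
  classical
  set F := frobeniusInt S with hF
  have hgr := isGreatest_frobeniusInt S hS
  have hlarge : ∀ x : ℤ, F < x → x ∈ intElements S := by
    intro x hx
    by_contra hn
    exact absurd (hgr.2 hn) (not_le.2 hx)
  have hFge : -1 ≤ F := hgr.2 fun hn => absurd (nonneg_of_mem_intElements hn) (by norm_num)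
  set A := (Finset.Icc 0 F).filter (· ∈ intElements S)
  set B := (Finset.Icc 0 F).filter (· ∉ intElements S)
  set C := B.filter (fun x => F - x ∉ intElements S)
  have hAB : (A.card : ℤ) + B.card = F + 1 := by
    have := Finset.card_filter_add_card_filter_not (s := Finset.Icc 0 F) (· ∈ intElements S)
    rw [Int.card_Icc] at this
    simp only [A, B]
    omega
  have hBA : (B.filter (fun x => ¬ (F - x ∉ intElements S))).card = A.card := by
    refine Finset.card_bij' (fun x _ => F - x) (fun x _ => F - x) ?_ ?_ ?_ ?_
    · intro x hx
      simp only [A, B, Finset.mem_filter, Finset.mem_Icc, not_not] at hx ⊢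
      exact ⟨by omega, hx.2⟩
    · intro x hx
      simp only [A, B, Finset.mem_filter, Finset.mem_Icc, not_not] at hx ⊢
      refine ⟨⟨by omega, fun hn => hgr.1 ?_⟩, by simpa using hx.2⟩
      have := add_mem_intElements hn hx.2
      simpa using this
    · intro x _; ring
    · intro x _; ring
  have hBC := Finset.card_filter_add_card_filter_not (s := B) (fun x => F - x ∉ intElements S)
  have hC : symmetryDefect S = (C : Set ℤ) := by
    ext x
    simp only [symmetryDefect, Set.mem_ofPred_eq, C, B, Finset.coe_filter, Finset.mem_filter,
      Finset.mem_Icc, ← hF]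
    refine ⟨fun h => ⟨⟨⟨?_, ?_⟩, h.1⟩, h.2⟩, fun h => ⟨h.1.2, h.2⟩⟩
    · by_contra hn
      exact h.2 (hlarge _ (by omega))
    · exact hgr.2 h.1
  have hg : genus S = B.card := by
    rw [genus, ← Set.ncard_coe_finset, ← Set.ncard_image_of_injective _ (Nat.cast_injective (R := ℤ))]
    congr 1
    ext x
    simp only [Set.mem_image, Set.mem_compl_iff, SetLike.mem_coe, B, Finset.coe_filter,
      Finset.mem_Icc, Set.mem_ofPred_eq]
    constructor
    · rintro ⟨s, hs, rfl⟩
      have : (s : ℤ) ∉ intElements S := fun h => hs (natCast_mem_intElements.1 h)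
      exact ⟨⟨Int.natCast_nonneg s, hgr.2 this⟩, this⟩
    · rintro ⟨⟨h0, -⟩, hx⟩
      obtain ⟨s, rfl⟩ := Int.eq_ofNat_of_zero_le h0
      exact ⟨s, fun h => hx (natCast_mem_intElements.2 h), rfl⟩
  refine ⟨hC ▸ C.finite_toSet, ?_⟩
  rw [hC, Set.ncard_coe_finset, hg]
  simp only [C]
  omega

theorem pseudoFrobenius_diff_subset {S : AddSubmonoid ℕ} (hS : IsNumericalSemigroup S) :
    pseudoFrobenius S \ {frobeniusInt S} ⊆ symmetryDefect S := by
  rintro p ⟨⟨hp, hps⟩, hpF⟩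
  refine ⟨hp, ?_⟩
  rintro ⟨s, hs, hsF⟩
  have hsF : (s : ℤ) = frobeniusInt S - p := hsF
  have hs0 : s ≠ 0 := by
    rintro rfl
    apply hpF
    simp only [Set.mem_singleton_iff]
    push_cast at hsF
    omega
  have := hps s hs hs0
  rw [hsF, add_sub_cancel] at this
  exact (isGreatest_frobeniusInt S hS).1 this

theorem frobeniusInt_mem_pseudoFrobenius {S : AddSubmonoid ℕ} (hS : IsNumericalSemigroup S) :
    frobeniusInt S ∈ pseudoFrobenius S := by
  have hgr := isGreatest_frobeniusInt S hS
  refine ⟨hgr.1, fun s _ hs0 => ?_⟩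
  by_contra hn
  have := hgr.2 hn
  omega

/-- The pseudo-Frobenius numbers of an almost symmetric semigroup of type three. -/
theorem IsAlmostSymmetric.exists_pair {S : AddSubmonoid ℕ} (hS : IsAlmostSymmetric S)
    (ht : semigroupType S = 3) :
    ∃ u v : ℤ, frobeniusInt S = u + v ∧ u ∈ pseudoFrobenius S ∧ v ∈ pseudoFrobenius S ∧
      Odd (u + v) ∧ ∀ x, x ∉ intElements S → x ≠ u → x ≠ v → u + v - x ∈ intElements S := by
  obtain ⟨hnum, hsym⟩ := hS
  obtain ⟨hfin, hg⟩ := two_mul_genus hnum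
  have hF := frobeniusInt_mem_pseudoFrobenius hnum
  have hPF : (pseudoFrobenius S).Finite := by
    refine (hfin.insert (frobeniusInt S)).subset fun p hp => ?_
    by_cases h : p = frobeniusInt S
    · exact Or.inl h
    · exact Or.inr (pseudoFrobenius_diff_subset hnum ⟨hp, h⟩)
  have hcard : (pseudoFrobenius S \ {frobeniusInt S}).ncard = 2 := by
    have := Set.ncard_sdiff_singleton_of_mem hF
    rw [this]
    unfold semigroupType at ht
    omega
  have heq : pseudoFrobenius S \ {frobeniusInt S} = symmetryDefect S := by
    refine Set.eq_of_subset_of_ncard_le (pseudoFrobenius_diff_subset hnum) ?_ hfin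
    rw [hcard]
    omega
  -- For type three, `F = 2g - 3`.
  have hodd : Odd (frobeniusInt S) := ⟨genus S - 2, by omega⟩
  rw [heq] at hcard
  obtain ⟨u, v, huv, hset⟩ := Set.ncard_eq_two.1 hcard
  have hu : u ∈ symmetryDefect S := by simp [hset]
  have hv : v ∈ symmetryDefect S := by simp [hset]
  have hu' : frobeniusInt S - u ∈ symmetryDefect S := ⟨hu.2, by simpa using hu.1⟩
  -- The reflection `x ↦ F - x` permutes the two-element defect and, `F` being odd, has no fixed
  -- point; so it swaps `u` and `v`.
  have hsum : frobeniusInt S = u + v := by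
    rw [hset] at hu'
    rcases hu' with h | h
    · obtain ⟨k, hk⟩ := hodd
      omega
    · simp only [Set.mem_singleton_iff] at h
      omega
  rw [← heq] at hu hv
  refine ⟨u, v, hsum, hu.1, hv.1, hsum ▸ hodd, fun x hx hxu hxv => ?_⟩
  by_contra hn
  rw [← hsum] at hn
  have : x ∈ symmetryDefect S := ⟨hx, hn⟩
  rw [hset] at this
  rcases this with h | h
  · exact hxu h
  · exact hxv h

/-- A semigroup with the gap structure `f, 2 * f, 3 * f` is almost symmetric of type three. -/
theorem isAlmostSymmetric_of_multiples {S : AddSubmonoid ℕ} (hnum : IsNumericalSemigroup S) {f : ℤ}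
    (hpos : 0 < f) (hf : ∀ m : ℤ, 0 < m → m ≤ 3 → m * f ∉ intElements S)
    (hadd : ∀ s ∈ S, s ≠ 0 → f + s ∈ intElements S)
    (hadd2 : ∀ s ∈ S, s ≠ 0 → 2 * f + s ∈ intElements S)
    (hdual : ∀ x : ℤ, x ∈ intElements S ∨ 3 * f - x ∈ intElements S ∨ x = f ∨ x = 2 * f) :
    IsAlmostSymmetric S ∧ semigroupType S = 3 := by
  have h1 : f ∉ intElements S := by simpa using hf 1 (by norm_num) (by norm_num)
  have h2 := hf 2 (by norm_num) (by norm_num)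
  have h3 := hf 3 (by norm_num) (by norm_num)
  have hF : frobeniusInt S = 3 * f := by
    refine (isGreatest_frobeniusInt S hnum).unique ⟨h3, fun x hx => ?_⟩
    rcases hdual x with h | h | h | h
    · exact absurd h hx
    · have := nonneg_of_mem_intElements h
      omega
    · omega
    · omega
  have hdef : symmetryDefect S = {f, 2 * f} := by
    ext x
    simp only [symmetryDefect, Set.mem_ofPred_eq, hF, Set.mem_insert_iff, Set.mem_singleton_iff]
    constructor
    · rintro ⟨hx, hx'⟩
      have := hdual x
      tauto
    · rintro (rfl | rfl)
      · exact ⟨h1, by convert h2 using 2; ring⟩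
      · exact ⟨h2, by convert h1 using 2; ring⟩
  have hPF : pseudoFrobenius S = {3 * f, f, 2 * f} := by
    ext p
    constructor
    · intro hp
      by_cases h : p = frobeniusInt S
      · exact Or.inl (hF ▸ h)
      · exact Or.inr (hdef ▸ pseudoFrobenius_diff_subset hnum ⟨hp, h⟩)
    · rintro (rfl | rfl | rfl)
      · exact hF ▸ frobeniusInt_mem_pseudoFrobenius hnum
      · exact ⟨h1, hadd⟩
      · exact ⟨h2, hadd2⟩
  have htype : semigroupType S = 3 := by
    rw [semigroupType, hPF, Set.ncard_eq_three]
    exact ⟨_, _, _, by omega, by omega, by omega, rfl⟩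
  refine ⟨⟨hnum, ?_⟩, htype⟩
  rw [(two_mul_genus hnum).2, htype, hdef, Set.ncard_pair (by omega)]
  push_cast
  ring

end Counting

/-! ### Factorizations over four generators -/

section Generators

theorem mem_closure_range_iff_sum {n : Fin 4 → ℕ} {s : ℕ} :
    s ∈ AddSubmonoid.closure (Set.range n) ↔
      ∃ c : Fin 4 → ℕ, s = c 0 * n 0 + c 1 * n 1 + c 2 * n 2 + c 3 * n 3 := by
  constructor
  · intro hs
    induction hs using AddSubmonoid.closure_induction with
    | mem x hx =>
      obtain ⟨i, rfl⟩ := hx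
      refine ⟨Pi.single i 1, ?_⟩
      fin_cases i <;> simp
    | zero => exact ⟨0, by simp⟩
    | add x y _ _ ihx ihy =>
      obtain ⟨c, rfl⟩ := ihx
      obtain ⟨d, rfl⟩ := ihy
      exact ⟨c + d, by simp only [Pi.add_apply]; ring⟩
  · rintro ⟨c, rfl⟩
    have : ∀ i, c i * n i ∈ AddSubmonoid.closure (Set.range n) := fun i => by
      rw [← smul_eq_mul]
      exact nsmul_mem (AddSubmonoid.subset_closure (Set.mem_range_self i)) _
    exact add_mem (add_mem (add_mem (this 0) (this 1)) (this 2)) (this 3)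

theorem exists_sum_of_mem_closure_ne {n : Fin 4 → ℕ} {i : Fin 4} {s : ℕ}
    (hs : s ∈ AddSubmonoid.closure (n '' {j | j ≠ i})) :
    ∃ c : Fin 4 → ℕ, c i = 0 ∧ s = c 0 * n 0 + c 1 * n 1 + c 2 * n 2 + c 3 * n 3 := by
  induction hs using AddSubmonoid.closure_induction with
  | mem x hx =>
    obtain ⟨j, hj, rfl⟩ := hx
    refine ⟨Pi.single j 1, Pi.single_eq_of_ne (Ne.symm hj) _, ?_⟩
    fin_cases j <;> simp
  | zero => exact ⟨0, by simp⟩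
  | add x y _ _ ihx ihy =>
    obtain ⟨c, hc, rfl⟩ := ihx
    obtain ⟨d, hd, rfl⟩ := ihy
    exact ⟨c + d, by simp [hc, hd], by simp only [Pi.add_apply]; ring⟩

theorem isUnit_of_gcd_eq_one {n : Fin 4 → ℕ} (h : Finset.univ.gcd n = 1) (d : ℤ)
    (hd : ∀ i, d ∣ (n i : ℤ)) : IsUnit d := by
  have : d.natAbs ∣ Finset.univ.gcd n :=
    Finset.dvd_gcd fun i _ => Int.natCast_dvd_natCast.1 (Int.natAbs_dvd.2 (hd i))
  rw [h, Nat.dvd_one] at this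
  exact Int.isUnit_iff_natAbs_eq.2 this

end Generators

/-! ### The direct statement: `gens α` generates an almost symmetric semigroup of type three -/

section Construction

variable {α : Fin 4 → ℕ}

theorem gens_cast (hα : ∀ i, 1 < α i) :
    (gens α 0 : ℤ) = ((α 1 : ℤ) - 1) * (α 2 - 1) * (α 3 - 1 + 1) + (α 1 - 1) + 1 ∧
    (gens α 1 : ℤ) = ((α 2 : ℤ) - 1) * (α 3 - 1) * (α 0 - 1 + 1) + (α 2 - 1) + 1 ∧
    (gens α 2 : ℤ) = ((α 3 : ℤ) - 1) * (α 0 - 1) * (α 1 - 1 + 1) + (α 3 - 1) + 1 ∧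
    (gens α 3 : ℤ) = ((α 0 : ℤ) - 1) * (α 1 - 1) * (α 2 - 1 + 1) + (α 0 - 1) + 1 := by
  have h : ∀ i, ((α i - 1 : ℕ) : ℤ) = (α i : ℤ) - 1 := fun i => by
    have := hα i
    omega
  refine ⟨?_, ?_, ?_, ?_⟩ <;> simp [gens, h] <;> ring

theorem cyclicRelations_gens (hα : ∀ i, 1 < α i) :
    CyclicRelations (fun i => (α i : ℤ) - 1) (fun i => (gens α i : ℤ))
      (((α 0 : ℤ) - 1) * (α 1 - 1) * (α 2 - 1) * (α 3 - 1) - 1) := by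
  obtain ⟨h0, h1, h2, h3⟩ := gens_cast hα
  refine ⟨fun i => by have := hα i; omega, ?_, ?_, ?_, ?_⟩ <;>
    simp only [smul_eq_mul, h0, h1, h2, h3] <;> ring

/-- The construction is cyclically symmetric, so the case of index `0`,
`CyclicRelations.zero_ne_sum`, is transported by rotation. -/
theorem gens_notMem_closure (hα : ∀ i, 1 < α i) (hgcd : Finset.univ.gcd (gens α) = 1) (i : Fin 4) :
    gens α i ∉ AddSubmonoid.closure (gens α '' {j | j ≠ i}) := by
  intro hi
  obtain ⟨c, hc, hs⟩ := exists_sum_of_mem_closure_ne hi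
  obtain ⟨h0, h1, h2, h3⟩ := gens_cast hα
  have h := cyclicRelations_gens hα
  have hu := isUnit_of_gcd_eq_one hgcd
  have hs' : (gens α i : ℤ) = c 0 * gens α 0 + c 1 * gens α 1 + c 2 * gens α 2 + c 3 * gens α 3 := by
    exact_mod_cast hs
  have hu' : ∀ (k : Fin 4) (d : ℤ), (∀ i, d ∣ (gens α (i + k) : ℤ)) → IsUnit d := fun k d hd =>
    hu d fun i => by simpa using hd (i - k)
  fin_cases i <;> simp only [Fin.mk_zero, Fin.mk_one, Fin.reduceFinMk] at hc hs'
  · refine h.zero_ne_sum h0 h1 hu (x := fun i => c i) (fun i => by positivity) ?_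
    simp only [hc] at hs' ⊢
    linear_combination hs'
  · refine h.rotate.zero_ne_sum h1 h2 (hu' 1) (x := fun i => c (i + 1)) (fun i => by positivity) ?_
    simp only [hc, Fin.reduceAdd, Fin.isValue] at hs' ⊢
    linear_combination hs'
  · refine h.rotate.rotate.zero_ne_sum h2 h3 (fun d hd => hu d fun i => ?_)
      (x := fun i => c (i + 1 + 1)) (fun i => by positivity) ?_
    · simpa using hd (i - 1 - 1)
    simp only [hc, Fin.reduceAdd, Fin.isValue] at hs' ⊢
    linear_combination hs'
  · refine h.rotate.rotate.rotate.zero_ne_sum h3 h0 (fun d hd => hu d fun i => ?_)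
      (x := fun i => c (i + 1 + 1 + 1)) (fun i => by positivity) ?_
    · simpa using hd (i - 1 - 1 - 1)
    simp only [hc, Fin.reduceAdd, Fin.isValue] at hs' ⊢
    linear_combination hs'

theorem odd_gens (hα : ∀ i, Odd (α i) ∧ 1 < α i) (i : Fin 4) : Odd (gens α i) := by
  have he : ∀ i, Even (α i - 1) := fun i => (hα i).1.tsub_odd odd_one
  fin_cases i
  · exact (((he 1).mul_right _).mul_right _).add_odd (hα 1).1
  · exact (((he 2).mul_right _).mul_right _).add_odd (hα 2).1
  · exact (((he 3).mul_right _).mul_right _).add_odd (hα 3).1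
  · exact (((he 0).mul_right _).mul_right _).add_odd (hα 0).1

theorem mem_intElements_closure_iff {n : Fin 4 → ℕ} {x : ℤ} :
    x ∈ intElements (AddSubmonoid.closure (Set.range n)) ↔
      ∃ c : Fin 4 → ℕ, x = c 0 * n 0 + c 1 * n 1 + c 2 * n 2 + c 3 * n 3 := by
  constructor
  · rintro ⟨s, hs, rfl⟩
    obtain ⟨c, rfl⟩ := mem_closure_range_iff_sum.1 hs
    exact ⟨c, by push_cast; rfl⟩
  · rintro ⟨c, rfl⟩
    exact ⟨_, mem_closure_range_iff_sum.2 ⟨c, rfl⟩, by push_cast; rfl⟩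

/-- The elements of `S` as an additive submonoid of the integers. -/
def intSubmonoid (S : AddSubmonoid ℕ) : AddSubmonoid ℤ where
  carrier := intElements S
  zero_mem' := zero_mem_intElements S
  add_mem' := add_mem_intElements

theorem mem_intSubmonoid {S : AddSubmonoid ℕ} {x : ℤ} : x ∈ intSubmonoid S ↔ x ∈ intElements S :=
  Iff.rfl

theorem closure_range_eq_top {n : Fin 4 → ℕ} (h : Finset.univ.gcd n = 1) :
    AddSubgroup.closure (Set.range fun i => (n i : ℤ)) = ⊤ := by
  obtain ⟨d, hd⟩ := Int.subgroup_cyclic (AddSubgroup.closure (Set.range fun i => (n i : ℤ)))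
  have hdvd : ∀ i, d ∣ (n i : ℤ) := fun i => by
    have : (n i : ℤ) ∈ AddSubgroup.closure {d} := hd ▸ AddSubgroup.subset_closure ⟨i, rfl⟩
    exact Int.mem_zmultiples_iff.1 (by rwa [AddSubgroup.zmultiples_eq_closure])
  have hu := isUnit_of_gcd_eq_one h d hdvd
  rw [hd, eq_top_iff]
  intro x _
  rw [← AddSubgroup.zmultiples_eq_closure]
  exact Int.mem_zmultiples_iff.2 hu.dvd

theorem isAlmostSymmetric_gens (hα : ∀ i, 1 < α i) (hgcd : Finset.univ.gcd (gens α) = 1) :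
    IsAlmostSymmetric (AddSubmonoid.closure (Set.range (gens α))) ∧
      semigroupType (AddSubmonoid.closure (Set.range (gens α))) = 3 := by
  set S := AddSubmonoid.closure (Set.range (gens α)) with hS
  obtain ⟨h0, h1, h2, h3⟩ := gens_cast hα
  have h := cyclicRelations_gens hα
  have hu := isUnit_of_gcd_eq_one hgcd
  set f : ℤ := ((α 0 : ℤ) - 1) * (α 1 - 1) * (α 2 - 1) * (α 3 - 1) - 1 with hfdef
  have hgen : ∀ i, (gens α i : ℤ) ∈ intElements S := fun i =>
    ⟨_, AddSubmonoid.subset_closure (Set.mem_range_self i), rfl⟩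
  have hmul : ∀ (k : ℤ) (i : Fin 4), 0 ≤ k → k * gens α i ∈ intElements S := by
    intro k i hk
    obtain ⟨m, rfl⟩ := Int.eq_ofNat_of_zero_le hk
    rw [← smul_eq_mul, natCast_zsmul]
    exact nsmul_mem (S := intSubmonoid S) (hgen i) m
  have hdual : ∀ x : ℤ, x ∈ intElements S ∨ 3 * f - x ∈ intElements S ∨ x = f ∨ x = 2 * f := by
    intro x
    have := h.mem_or_sub_mem (M := intSubmonoid S) hgen (x := x)
      (by rw [closure_range_eq_top hgcd]; trivial)
    simpa only [mem_intSubmonoid, smul_eq_mul] using this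
  have hf : ∀ m : ℤ, 0 < m → m ≤ 3 → m * f ∉ intElements S := by
    intro m m0 m3 hm
    obtain ⟨c, hc⟩ := mem_intElements_closure_iff.1 hm
    exact h.not_mul_eq_sum h0 h1 hu m0 m3 (x := fun i => c i) (fun i => by positivity) hc
  have hf0 : 0 ≤ f := by
    have := h.pos 0
    have := h.pos 1
    have := h.pos 2
    have := h.pos 3
    have := one_le_mul_of_one_le_of_one_le (one_le_mul_of_one_le_of_one_le
      (one_le_mul_of_one_le_of_one_le (h.pos 0) (h.pos 1)) (h.pos 2)) (h.pos 3)
    simpa [hfdef] using this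
  have hfpos : 0 < f := by
    refine lt_of_le_of_ne hf0 fun h0 => hf 1 (by norm_num) (by norm_num) ?_
    rw [← h0]
    exact zero_mem_intElements S
  -- By duality no gap exceeds `3f`.
  have hnum : IsNumericalSemigroup S := by
    refine (Set.finite_le_nat (3 * f).toNat).subset fun s hs => ?_
    simp only [Set.mem_ofPred_eq]
    by_contra hlt
    have hs' : (s : ℤ) ∉ intElements S := fun h => hs (natCast_mem_intElements.1 h)
    rcases hdual s with h | h | h | h
    · exact hs' h
    · have := nonneg_of_mem_intElements h
      omega
    · omega
    · omega
  have hpos := fun i => hα i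
  have r0 := h.rel0
  have r1 := h.rel1
  have r2 := h.rel2
  have r3 := h.rel3
  simp only [smul_eq_mul] at r0 r1 r2 r3
  have g1 : ∀ i, f + gens α i ∈ intElements S := by
    intro i
    fin_cases i
    · exact r0 ▸ hmul _ _ (by linarith [h.pos 1])
    · exact r1 ▸ hmul _ _ (by linarith [h.pos 2])
    · exact r2 ▸ hmul _ _ (by linarith [h.pos 3])
    · exact r3 ▸ hmul _ _ (by linarith [h.pos 0])
  have hadd2 : ∀ {k : ℤ} {i j : Fin 4}, 1 ≤ k → f + gens α i = k * gens α j →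
      2 * f + gens α i ∈ intElements S := by
    intro k i j hk hij
    -- One of the `k ≥ 1` copies of `n j` absorbs the second `f`.
    have : 2 * f + gens α i = (k - 1) * gens α j + (f + gens α j) := by linear_combination hij
    rw [this]
    exact add_mem_intElements (hmul _ _ (by omega)) (g1 j)
  have g2 : ∀ i, 2 * f + gens α i ∈ intElements S := by
    intro i
    fin_cases i
    · exact hadd2 (h.pos 1) r0
    · exact hadd2 (h.pos 2) r1
    · exact hadd2 (h.pos 3) r2
    · exact hadd2 (h.pos 0) r3
  have hext : ∀ p : ℤ, (∀ i, p + gens α i ∈ intElements S) →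
      ∀ s ∈ S, s ≠ 0 → p + (s : ℤ) ∈ intElements S := by
    intro p hp s hs
    induction hs using AddSubmonoid.closure_induction with
    | mem x hx =>
      obtain ⟨i, rfl⟩ := hx
      exact fun _ => hp i
    | zero => simp
    | add x y hx hy ihx ihy =>
      intro hxy
      by_cases hx0 : x = 0
      · subst hx0
        simpa using ihy (by simpa using hxy)
      · have := add_mem_intElements (ihx hx0) (natCast_mem_intElements.2 hy)
        simpa [add_assoc] using this
  exact isAlmostSymmetric_of_multiples hnum hfpos hf (hext f g1) (hext (2 * f) g2) hdual

end Construction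

/-! ### Arrows and factorizations for the two smaller pseudo-Frobenius numbers -/

/-- `u` and `v` are the two pseudo-Frobenius numbers below the Frobenius number `u + v` of an
almost symmetric semigroup `T` of type three, minimally generated by four odd numbers `n i`. -/
structure DualPair (T : AddSubmonoid ℤ) (n : Fin 4 → ℤ) (u v : ℤ) : Prop where
  pos : ∀ i, 0 < n i
  odd : ∀ i, Odd (n i)
  gen_mem : ∀ i, n i ∈ T
  exists_sum : ∀ x ∈ T, ∃ c : Fin 4 → ℤ, (∀ i, 0 ≤ c i) ∧ x = ∑ i, c i * n i
  gen_sub_notMem : ∀ i j, i ≠ j → n i - n j ∉ T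
  left_notMem : u ∉ T
  right_notMem : v ∉ T
  add_notMem : u + v ∉ T
  left_add_mem : ∀ i, u + n i ∈ T
  right_add_mem : ∀ i, v + n i ∈ T
  dual : ∀ x, x ∉ T → x ≠ u → x ≠ v → u + v - x ∈ T
  odd_add : Odd (u + v)

/-- Some factorization of `u + n i` involves `n j`. -/
def Arrow (T : AddSubmonoid ℤ) (n : Fin 4 → ℤ) (u : ℤ) (i j : Fin 4) : Prop :=
  u + n i - n j ∈ T

/-- The four indices are distinct. -/
def Distinct (i j k l : Fin 4) : Prop :=
  i ≠ j ∧ i ≠ k ∧ i ≠ l ∧ j ≠ k ∧ j ≠ l ∧ k ≠ l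

instance (i j k l : Fin 4) : Decidable (Distinct i j k l) := by
  unfold Distinct
  infer_instance

/-- No multiple `k * n j` with `1 ≤ k ≤ a` is a combination of the other generators. -/
def Capped (n : Fin 4 → ℤ) (j : Fin 4) (a : ℤ) : Prop :=
  ∀ i k l, Distinct j i k l → ∀ t x y z : ℤ, 1 ≤ t → t ≤ a → 0 ≤ x → 0 ≤ y → 0 ≤ z →
    t * n j ≠ x * n i + y * n k + z * n l

theorem Distinct.univ_eq : ∀ {i j k l : Fin 4}, Distinct i j k l →
    (Finset.univ : Finset (Fin 4)) = {i, j, k, l} := by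
  decide

theorem Distinct.sum_eq {i j k l : Fin 4} (h : Distinct i j k l) (f : Fin 4 → ℤ) :
    ∑ m, f m = f i + f j + f k + f l := by
  obtain ⟨h1, h2, h3, h4, h5, h6⟩ := id h
  rw [h.univ_eq, Finset.sum_insert (by simp [h1, h2, h3]), Finset.sum_insert (by simp [h4, h5]),
    Finset.sum_insert (by simp [h6]), Finset.sum_singleton]
  ring

namespace DualPair

variable {T : AddSubmonoid ℤ} {n : Fin 4 → ℤ} {u v : ℤ}

theorem symm (h : DualPair T n u v) : DualPair T n v u where
  pos := h.pos
  odd := h.odd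
  gen_mem := h.gen_mem
  exists_sum := h.exists_sum
  gen_sub_notMem := h.gen_sub_notMem
  left_notMem := h.right_notMem
  right_notMem := h.left_notMem
  add_notMem := add_comm u v ▸ h.add_notMem
  left_add_mem := h.right_add_mem
  right_add_mem := h.left_add_mem
  dual x hx hxv hxu := add_comm u v ▸ h.dual x hx hxu hxv
  odd_add := add_comm u v ▸ h.odd_add

theorem reindex (h : DualPair T n u v) {σ : Fin 4 → Fin 4} (hσ : Function.Bijective σ) :
    DualPair T (n ∘ σ) u v where
  pos i := h.pos _
  odd i := h.odd _
  gen_mem i := h.gen_mem _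
  exists_sum x hx := by
    obtain ⟨c, hc, rfl⟩ := h.exists_sum x hx
    exact ⟨c ∘ σ, fun i => hc _, (hσ.sum_comp fun i => c i * n i).symm⟩
  gen_sub_notMem i j hij := h.gen_sub_notMem _ _ (hσ.injective.ne hij)
  left_notMem := h.left_notMem
  right_notMem := h.right_notMem
  add_notMem := h.add_notMem
  left_add_mem i := h.left_add_mem _
  right_add_mem i := h.right_add_mem _
  dual := h.dual
  odd_add := h.odd_add

theorem mul_mem (h : DualPair T n u v) {k : ℤ} (hk : 0 ≤ k) (i : Fin 4) : k * n i ∈ T := by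
  obtain ⟨m, rfl⟩ := Int.eq_ofNat_of_zero_le hk
  rw [← smul_eq_mul, natCast_zsmul]
  exact nsmul_mem (h.gen_mem i) m

theorem comb_mem (h : DualPair T n u v) {x y z : ℤ} (hx : 0 ≤ x) (hy : 0 ≤ y) (hz : 0 ≤ z)
    (i j k : Fin 4) : x * n i + y * n j + z * n k ∈ T :=
  add_mem (add_mem (h.mul_mem hx i) (h.mul_mem hy j)) (h.mul_mem hz k)

theorem even_iff (h : DualPair T n u v) (k : ℤ) (i : Fin 4) : Even (k * n i) ↔ Even k := by
  have : ¬ Even (n i) := Int.not_even_iff_odd.2 (h.odd i)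
  simp [Int.even_mul, this]

theorem even_comb_iff (h : DualPair T n u v) (x y : ℤ) (i j : Fin 4) :
    Even (x * n i + y * n j) ↔ Even (x + y) := by
  simp only [Int.even_add, h.even_iff]

theorem even_add_iff (h : DualPair T n u v) (i : Fin 4) : Even (u + n i) ↔ Odd u := by
  have : ¬ Even (n i) := Int.not_even_iff_odd.2 (h.odd i)
  simp [Int.even_add, this]

theorem odd_left_iff (h : DualPair T n u v) : Odd u ↔ Even v := by
  have := h.odd_add
  rw [Int.odd_add] at this
  exact this

theorem odd_right_iff (h : DualPair T n u v) : Odd v ↔ Even u :=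
  h.symm.odd_left_iff

theorem eq_zero_or_exists_sub_mem (h : DualPair T n u v) {x : ℤ} (hx : x ∈ T) :
    x = 0 ∨ ∃ i, x - n i ∈ T := by
  obtain ⟨c, hc, rfl⟩ := h.exists_sum x hx
  by_cases h0 : ∀ i, c i = 0
  · left
    simp [h0]
  · right
    push Not at h0
    obtain ⟨i, hi⟩ := h0
    refine ⟨i, ?_⟩
    rw [← Finset.add_sum_erase _ _ (Finset.mem_univ i)]
    have : c i * n i + ∑ m ∈ Finset.univ.erase i, c m * n m - n i =
        (c i - 1) * n i + ∑ m ∈ Finset.univ.erase i, c m * n m := by ring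
    rw [this]
    have := hc i
    exact add_mem (h.mul_mem (by omega) _) (sum_mem fun m _ => h.mul_mem (hc m) _)

/-- The difference is nonzero because `u + v` is odd; if it were in `T`, some generator could be
subtracted, and adding `v + n i` would put `u` into `T`. -/
theorem left_sub_right_notMem (h : DualPair T n u v) : u - v ∉ T := by
  intro hm
  rcases h.eq_zero_or_exists_sub_mem hm with h0 | ⟨i, hi⟩
  · have := h.odd_add
    rw [show u + v = v + v by linarith] at this
    exact (Int.not_even_iff_odd.2 this) ⟨v, rfl⟩
  · apply h.left_notMem
    have := add_mem hi (h.right_add_mem i)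
    convert this using 1
    ring

/-- Exactly one of two opposite arrows exists. -/
theorem arrow_iff (h : DualPair T n u v) {i j : Fin 4} (hij : i ≠ j) :
    Arrow T n u i j ↔ ¬ Arrow T n v j i := by
  unfold Arrow
  constructor
  · intro h1 h2
    apply h.add_notMem
    convert add_mem h1 h2 using 1
    ring
  · intro h2
    by_contra h1
    apply h2
    have := h.dual _ h1 (fun heq => h.gen_sub_notMem i j hij ?_) (fun heq => ?_)
    · convert this using 1
      ring
    · rw [show n i - n j = 0 by linarith]
      exact T.zero_mem
    -- The other exception, `u + n i - n j = v`, is excluded by parity: this is where oddness of the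
    -- generators enters.
    · have h3 : u + v + n i = 2 * v + n j := by linarith
      have h4 : Even (u + v + n i) := h.odd_add.add_odd (h.odd i)
      rw [h3] at h4
      exact (Int.not_even_iff_odd.2 ((even_two_mul v).add_odd (h.odd j))) h4

/-- A factorization of `u + n i` using `n i` itself would put `u` into `T`. -/
theorem row (h : DualPair T n u v) {i j k l : Fin 4} (hd : Distinct i j k l) :
    ∃ x y z : ℤ, 0 ≤ x ∧ 0 ≤ y ∧ 0 ≤ z ∧ u + n i = x * n j + y * n k + z * n l := by
  obtain ⟨c, hc, hs⟩ := h.exists_sum _ (h.left_add_mem i)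
  rw [hd.sum_eq] at hs
  have hci : c i = 0 := by
    by_contra hne
    apply h.left_notMem
    have := hc i
    have h1 : u = (c i - 1) * n i + (c j * n j + c k * n k + c l * n l) := by linear_combination hs
    rw [h1]
    exact add_mem (h.mul_mem (by omega) _) (h.comb_mem (hc j) (hc k) (hc l) _ _ _)
  exact ⟨c j, c k, c l, hc j, hc k, hc l, by rw [hs, hci]; ring⟩

theorem row_of_arrow (h : DualPair T n u v) {i j k l : Fin 4} (hd : Distinct i j k l)
    (ha : Arrow T n u i j) :
    ∃ x y z : ℤ, 1 ≤ x ∧ 0 ≤ y ∧ 0 ≤ z ∧ u + n i = x * n j + y * n k + z * n l := by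
  obtain ⟨c, hc, hs⟩ := h.exists_sum _ ha
  rw [hd.sum_eq] at hs
  have hci : c i = 0 := by
    by_contra hne
    apply h.left_notMem
    have := hc i
    have h1 : u = (c i - 1) * n i + ((c j + 1) * n j + c k * n k + c l * n l) := by
      linear_combination hs
    rw [h1]
    exact add_mem (h.mul_mem (by omega) _) (h.comb_mem (by linarith [hc j]) (hc k) (hc l) _ _ _)
  refine ⟨c j + 1, c k, c l, by linarith [hc j], hc k, hc l, ?_⟩
  rw [hci] at hs
  linear_combination hs

theorem coeff_eq_zero (h : DualPair T n u v) {i j k l : Fin 4} {x y z : ℤ} (hx : 0 ≤ x)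
    (hy : 0 ≤ y) (hz : 0 ≤ z) (hs : u + n i = x * n j + y * n k + z * n l)
    (ha : ¬ Arrow T n u i j) : x = 0 := by
  by_contra hne
  apply ha
  have : u + n i - n j = (x - 1) * n j + y * n k + z * n l := by linear_combination hs
  rw [Arrow, this]
  exact h.comb_mem (by omega) hy hz _ _ _

/-- A row supported in two places. -/
theorem row_two (h : DualPair T n u v) {i j k l : Fin 4} (hd : Distinct i j k l)
    (hl : ¬ Arrow T n u i l) :
    ∃ x y : ℤ, 0 ≤ x ∧ 0 ≤ y ∧ u + n i = x * n j + y * n k := by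
  obtain ⟨x, y, z, hx, hy, hz, hs⟩ := h.row hd
  have : z = 0 := h.coeff_eq_zero (k := j) (l := k) hz hx hy (by rw [hs]; ring) hl
  exact ⟨x, y, hx, hy, by rw [hs, this]; ring⟩

theorem row_two_of_arrow (h : DualPair T n u v) {i j k l : Fin 4} (hd : Distinct i j k l)
    (hj : Arrow T n u i j) (hl : ¬ Arrow T n u i l) :
    ∃ x y : ℤ, 1 ≤ x ∧ 0 ≤ y ∧ u + n i = x * n j + y * n k := by
  obtain ⟨x, y, z, hx, hy, hz, hs⟩ := h.row_of_arrow hd hj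
  have : z = 0 := h.coeff_eq_zero (k := j) (l := k) hz (show 0 ≤ x by omega) hy (by rw [hs]; ring) hl
  exact ⟨x, y, hx, hy, by rw [hs, this]; ring⟩

/-- A row supported in one place. -/
theorem row_one (h : DualPair T n u v) {i j k l : Fin 4} (hd : Distinct i j k l)
    (hk : ¬ Arrow T n u i k) (hl : ¬ Arrow T n u i l) :
    ∃ a : ℤ, 1 ≤ a ∧ u + n i = a * n j ∧ Capped n j a := by
  obtain ⟨x, y, hx, hy, hs⟩ := h.row_two hd hl
  have hy0 : y = 0 := h.coeff_eq_zero (l := l) hy hx le_rfl (by rw [hs]; ring) hk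
  have hs' : u + n i = x * n j := by rw [hs, hy0]; ring
  have hx1 : x ≠ 0 := by
    rintro rfl
    obtain ⟨h1, h2, h3, h4, h5, h6⟩ := hd
    have h9 : u = -n i := by linarith
    exact absurd (h.left_add_mem k) (by
      rw [h9, show -n i + n k = n k - n i by ring]
      exact h.gen_sub_notMem k i (Ne.symm h2))
  refine ⟨x, by omega, hs', ?_⟩
  intro p q r hd' t b c d ht hta hb hc hd0 heq
  -- Exchanging `t * n j` for the other combination gives a factorization of `u + n i` using a
  -- generator different from `n j`: an excluded arrow, or `u ∈ T` if that generator is `n i`.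
  have hsum : u + n i = (x - t) * n j + (b * n p + c * n q + d * n r) := by
    linear_combination hs' + heq
  have hmem : b * n p + c * n q + d * n r ∈ T := h.comb_mem hb hc hd0 _ _ _
  have hpos : 0 < b * n p + c * n q + d * n r := by
    rw [← heq]
    exact mul_pos (by omega) (h.pos j)
  have hfin : ∀ m : Fin 4, m ≠ j → ∀ s ∈ T, u + n i ≠ n m + s := by
    intro m hm s hs0 he
    by_cases hmi : m = i
    · subst hmi
      exact h.left_notMem (by rwa [show u = s by linarith])
    · have hmkl : m = k ∨ m = l := by
        obtain ⟨h1, h2, h3, h4, h5, h6⟩ := hd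
        omega
      rcases hmkl with rfl | rfl
      · exact hk (by rw [Arrow, he]; simpa using hs0)
      · exact hl (by rw [Arrow, he]; simpa using hs0)
  obtain ⟨h1, h2, h3, -, -, -⟩ := hd'
  have key : ∀ b' p' c' q' d' r', 0 ≤ b' → 0 ≤ c' → 0 ≤ d' → p' ≠ j →
      b * n p + c * n q + d * n r = b' * n p' + c' * n q' + d' * n r' → b' = 0 := by
    intro b' p' c' q' d' r' hb' hc' hd' hp' he
    by_contra hne
    refine hfin p' hp' ((x - t) * n j + ((b' - 1) * n p' + c' * n q' + d' * n r'))
      (add_mem (h.mul_mem (by omega) _) (h.comb_mem (by omega) hc' hd' _ _ _)) ?_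
    rw [hsum, he]
    ring
  have e1 := key b p c q d r hb hc hd0 (Ne.symm h1) rfl
  have e2 := key c q b p d r hc hb hd0 (Ne.symm h2) (by ring)
  have e3 := key d r b p c q hd0 hb hc (Ne.symm h3) (by ring)
  rw [e1, e2, e3] at hpos
  simp at hpos

/-- Two rows of different numbers are not supported at the same single place. -/
theorem not_single_single (h : DualPair T n u v) {i j k l : Fin 4} (hd : Distinct i j k l)
    (h1 : ¬ Arrow T n u i k) (h2 : ¬ Arrow T n u i l) (h3 : ¬ Arrow T n v i k)
    (h4 : ¬ Arrow T n v i l) : False := by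
  obtain ⟨a, ha, hs, -⟩ := h.row_one hd h1 h2
  obtain ⟨b, hb, ht, -⟩ := h.symm.row_one hd h3 h4
  rcases le_total a b with hab | hab
  · apply h.symm.left_sub_right_notMem
    rw [show v - u = (b - a) * n j by linear_combination ht - hs]
    exact h.mul_mem (by omega) _
  · apply h.left_sub_right_notMem
    rw [show u - v = (a - b) * n j by linear_combination hs - ht]
    exact h.mul_mem (by omega) _

/-- Two different rows are not supported at the same single place. -/
theorem single_injective (h : DualPair T n u v) {i j k l : Fin 4} (hd : Distinct i j k l)
    (h1 : ¬ Arrow T n u i k) (h2 : ¬ Arrow T n u i l) (h3 : ¬ Arrow T n u k i)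
    (h4 : ¬ Arrow T n u k l) : False := by
  obtain ⟨d1, d2, d3, d4, d5, d6⟩ := id hd
  obtain ⟨a, ha, hs, -⟩ := h.row_one hd h1 h2
  obtain ⟨b, hb, ht, -⟩ := h.row_one (i := k) (j := j) (k := i) (l := l)
    ⟨d4.symm, d2.symm, d6, d1.symm, d5, d3⟩ h3 h4
  rcases le_total a b with hab | hab
  · apply h.gen_sub_notMem k i d2.symm
    rw [show n k - n i = (b - a) * n j by linear_combination ht - hs]
    exact h.mul_mem (by omega) _
  · apply h.gen_sub_notMem i k d2
    rw [show n i - n k = (a - b) * n j by linear_combination hs - ht]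
    exact h.mul_mem (by omega) _

/-- For even `u`, two rows cannot be supported at each other's index only. -/
theorem not_single_swap (h : DualPair T n u v) (hu : Even u) {i j k l : Fin 4}
    (hd : Distinct i j k l) (h1 : ¬ Arrow T n u i k) (h2 : ¬ Arrow T n u i l)
    (h3 : ¬ Arrow T n u j k) (h4 : ¬ Arrow T n u j l) : False := by
  obtain ⟨d1, d2, d3, d4, d5, d6⟩ := id hd
  obtain ⟨a, ha, hs, hcap⟩ := h.row_one hd h1 h2
  have hd' : Distinct j i k l := ⟨d1.symm, d4, d5, d2, d3, d6⟩
  obtain ⟨b, hb, ht, -⟩ := h.row_one hd' h3 h4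
  have odd_coeff : ∀ {c : ℤ} {p q : Fin 4}, u + n p = c * n q → Odd c := by
    intro c p q he
    rw [← Int.not_even_iff_odd, ← h.even_iff c q, ← he, h.even_add_iff]
    exact fun ho => (Int.not_even_iff_odd.2 ho) hu
  obtain ⟨r, hr⟩ := odd_coeff hs
  obtain ⟨s, hs'⟩ := odd_coeff ht
  -- Subtracting the rows gives `(a + 1) * n j = (b + 1) * n i`. Both coefficients are even, and the
  -- halved relation violates the cap, since `r + 1 ≤ 2 * r + 1 = a`.
  refine hcap i k l hd' (r + 1) (s + 1) 0 0 (by omega) (by omega) (by omega) le_rfl le_rfl ?_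
  subst hr hs'
  linarith

/-- If rows `i` and `j` are supported at each other's index only, then membership of integer
combinations of `n i` and `n j` is decided by `u`. -/
theorem comb_mem_or_sub (h : DualPair T n u v) {i j k l : Fin 4} (hd : Distinct i j k l)
    (h1 : ¬ Arrow T n u i k) (h2 : ¬ Arrow T n u i l) (h3 : ¬ Arrow T n u j k)
    (h4 : ¬ Arrow T n u j l) (c d : ℤ) :
    c * n i + d * n j ∈ T ∨
      ∃ p q : ℤ, 0 ≤ p ∧ 0 ≤ q ∧ u - (c * n i + d * n j) = p * n i + q * n j := by
  obtain ⟨d1, d2, d3, d4, d5, d6⟩ := id hd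
  obtain ⟨a, ha, hs, -⟩ := h.row_one hd h1 h2
  obtain ⟨b, hb, ht, -⟩ := h.row_one (i := j) (j := i) ⟨d1.symm, d4, d5, d2, d3, d6⟩ h3 h4
  -- The two rows give `(b + 1) * n i = (a + 1) * n j`, so the coefficient of `n i` can be reduced
  -- to `0 ≤ r ≤ b`. Since `u = b * n i - n j`, a negative coefficient of `n j` makes the difference
  -- from `u` a nonnegative combination.
  have hr0 := Int.emod_nonneg c (show b + 1 ≠ 0 by omega)
  have hr1 := Int.emod_lt_of_pos c (show 0 < b + 1 by omega)
  have hdiv := Int.mul_ediv_add_emod c (b + 1)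
  set r := c % (b + 1)
  set t := c / (b + 1)
  have hval : c * n i + d * n j = r * n i + (d + t * (a + 1)) * n j := by
    rw [← hdiv]
    linear_combination t * (hs - ht)
  rw [hval]
  rcases le_or_gt 0 (d + t * (a + 1)) with hd0 | hd0
  · left
    exact add_mem (h.mul_mem hr0 _) (h.mul_mem hd0 _)
  · right
    exact ⟨b - r, -1 - (d + t * (a + 1)), by omega, by omega, by linear_combination ht⟩

/-- The situation of `comb_mem_or_sub` when `n k - n l` is a combination of `n i` and `n j`. -/
theorem row_of_single_swap (h : DualPair T n u v) {i j k l : Fin 4} (hd : Distinct i j k l)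
    (h1 : ¬ Arrow T n u i k) (h2 : ¬ Arrow T n u i l) (h3 : ¬ Arrow T n u j k)
    (h4 : ¬ Arrow T n u j l) (h5 : ¬ Arrow T n v k l) (h6 : ¬ Arrow T n v l k) :
    ∃ p q : ℤ, 0 ≤ p ∧ 0 ≤ q ∧ u + n k = p * n i + q * n j + 1 * n l := by
  obtain ⟨d1, d2, d3, d4, d5, d6⟩ := id hd
  obtain ⟨p, q, hp, hq, hpq⟩ := h.symm.row_two (i := k) (j := i) (k := j) (l := l)
    ⟨d2.symm, d4.symm, d6, d1, d3, d5⟩ h5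
  obtain ⟨r, s, hr, hs, hrs⟩ := h.symm.row_two (i := l) (j := i) (k := j) (l := k)
    ⟨d3.symm, d5.symm, d6.symm, d1, d2, d4⟩ h6
  -- The coefficients are those of `n l - n k`, which is not in `T`.
  rcases h.comb_mem_or_sub hd h1 h2 h3 h4 (r - p) (s - q) with hm | ⟨x, y, hx, hy, hxy⟩
  · refine absurd ?_ (h.gen_sub_notMem l k d6.symm)
    convert hm using 1
    linear_combination hrs - hpq
  · exact ⟨x, y, hx, hy, by linear_combination hxy - hrs + hpq⟩

/-- The missing arrows reduce `row_of_single_swap` to `u + n k = n l`, an even number equal to an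
odd one. -/
theorem not_single_swap_of_odd (h : DualPair T n u v) (hu : Odd u) {i j k l : Fin 4}
    (hd : Distinct i j k l) (h1 : ¬ Arrow T n u i k) (h2 : ¬ Arrow T n u i l)
    (h3 : ¬ Arrow T n u j k) (h4 : ¬ Arrow T n u j l) (h5 : ¬ Arrow T n v k l)
    (h6 : ¬ Arrow T n v l k) (h7 : ¬ Arrow T n u k i) (h8 : ¬ Arrow T n u k j) : False := by
  obtain ⟨p, q, hp, hq, hpq⟩ := h.row_of_single_swap hd h1 h2 h3 h4 h5 h6
  have hp0 : p = 0 := h.coeff_eq_zero hp hq (by norm_num) hpq h7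
  have hq0 : q = 0 := h.coeff_eq_zero (k := i) (l := l) hq hp (z := 1) (by norm_num) (by rw [hpq]; ring) h8
  rw [hp0, hq0] at hpq
  have h9 : Even (u + n k) := (h.even_add_iff k).2 hu
  rw [hpq] at h9
  exact (Int.not_even_iff_odd.2 (h.odd l)) (by simpa using h9)

/-- The rows read `u + n i = x n j + y n k`, `u + n k = a n j` and `v + n i = c n k`, with `x < a`
and `y < c`. Subtracting the first two gives `(y + 1) n k = n i + (a - x) n j`, against the cap `c`
of `n k`. -/
theorem not_chain (h : DualPair T n u v) {i j k l : Fin 4} (hd : Distinct i j k l)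
    (h1 : ¬ Arrow T n u i l) (h2 : ¬ Arrow T n u k i) (h3 : ¬ Arrow T n u k l)
    (h4 : ¬ Arrow T n v i j) (h5 : ¬ Arrow T n v i l) : False := by
  obtain ⟨d1, d2, d3, d4, d5, d6⟩ := id hd
  obtain ⟨x, y, hx, hy, hxy⟩ := h.row_two hd h1
  obtain ⟨a, ha, hs, -⟩ := h.row_one (i := k) (j := j) (k := i) (l := l)
    ⟨d4.symm, d2.symm, d6, d1.symm, d5, d3⟩ h2 h3
  obtain ⟨c, hc, ht, hcap⟩ := h.symm.row_one (i := i) (j := k) (k := j) (l := l)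
    ⟨d2, d1, d3, d4.symm, d6, d5⟩ h4 h5
  have hyc : y < c := by
    by_contra hn
    apply h.left_sub_right_notMem
    rw [show u - v = x * n j + (y - c) * n k by linear_combination hxy - ht]
    exact add_mem (h.mul_mem hx _) (h.mul_mem (by omega) _)
  have hxa : x < a := by
    by_contra hn
    apply h.gen_sub_notMem i k d2
    rw [show n i - n k = (x - a) * n j + y * n k by linear_combination hxy - hs]
    exact add_mem (h.mul_mem (by omega) _) (h.mul_mem hy _)
  exact hcap i j l ⟨d2.symm, d4.symm, d6, d1, d3, d5⟩ (y + 1) 1 (a - x) 0 (by omega) (by omega)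
    (by norm_num) (by omega) le_rfl (by linear_combination hs - hxy)

end DualPair

/-! ### Excluding the four digraphs other than the cycle -/

/-- The arrows of `u` form the digraph with the given adjacency table. -/
def HasPattern (T : AddSubmonoid ℤ) (n : Fin 4 → ℤ) (u : ℤ) (t : Fin 4 → Fin 4 → Bool) : Prop :=
  ∀ i j, i ≠ j → (Arrow T n u i j ↔ t i j = true)

def cyclePattern : Fin 4 → Fin 4 → Bool :=
  ![![false, true, false, false], ![false, false, true, false],
    ![false, false, false, true], ![true, false, false, false]]

def lassoPattern : Fin 4 → Fin 4 → Bool :=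
  ![![false, true, true, false], ![true, false, false, false],
    ![false, false, false, true], ![false, true, false, false]]

def pathPattern : Fin 4 → Fin 4 → Bool :=
  ![![false, true, true, false], ![true, false, false, true],
    ![true, false, false, false], ![false, true, false, false]]

def linkedPattern : Fin 4 → Fin 4 → Bool :=
  ![![false, true, true, false], ![true, false, false, false],
    ![false, true, false, true], ![false, false, true, false]]

def squarePattern : Fin 4 → Fin 4 → Bool :=
  ![![false, true, true, false], ![true, false, false, true],
    ![false, false, false, true], ![false, false, true, false]]

/-- A short relation between three capped generators is trivial. -/
theorem Capped.eq_zero {n : Fin 4 → ℤ} {i j k l : Fin 4} (hd : Distinct i j k l) {a b c : ℤ}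
    (hi : Capped n i a) (hj : Capped n j b) (hk : Capped n k c) (pi : 0 < n i) (pj : 0 < n j)
    (pk : 0 < n k) {x y z : ℤ} (hx : -a ≤ x) (hx' : x ≤ a) (hy : -b ≤ y) (hy' : y ≤ b)
    (hz : -c ≤ z) (hz' : z ≤ c) (hs : x * n i + y * n j + z * n k = 0) :
    x = 0 ∧ y = 0 ∧ z = 0 := by
  obtain ⟨d1, d2, d3, d4, d5, d6⟩ := id hd
  have dj : Distinct j i k l := ⟨d1.symm, d4, d5, d2, d3, d6⟩
  have dk : Distinct k i j l := ⟨d2.symm, d4.symm, d6, d1, d3, d5⟩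
  -- In a nontrivial relation of three terms one term stands alone on its side, or all have the same
  -- sign; the first contradicts a cap, the second positivity.
  have hx0 : x = 0 := by
    rcases lt_trichotomy x 0 with h | h | h
    · rcases le_or_gt 0 y with h1 | h1
      · rcases le_or_gt 0 z with h2 | h2
        · exact (hi j k l hd (-x) y z 0 (by omega) (by omega) h1 h2 le_rfl
            (by linear_combination -hs)).elim
        · rcases h1.eq_or_lt with h3 | h3
          · subst h3
            nlinarith [mul_pos (neg_pos.2 h) pi, mul_pos (neg_pos.2 h2) pk]
          · exact (hj i k l dj y (-x) (-z) 0 (by omega) (by omega) (by omega) (by omega) le_rfl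
              (by linear_combination hs)).elim
      · rcases le_or_gt z 0 with h2 | h2
        · nlinarith [mul_pos (neg_pos.2 h) pi, mul_pos (neg_pos.2 h1) pj,
            mul_nonneg (neg_nonneg.2 h2) pk.le]
        · exact (hk i j l dk z (-x) (-y) 0 (by omega) (by omega) (by omega) (by omega) le_rfl
            (by linear_combination hs)).elim
    · exact h
    · rcases le_or_gt y 0 with h1 | h1
      · rcases le_or_gt z 0 with h2 | h2
        · exact (hi j k l hd x (-y) (-z) 0 (by omega) (by omega) (by omega) (by omega) le_rfl
            (by linear_combination hs)).elim
        · rcases h1.eq_or_lt with h3 | h3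
          · subst h3
            nlinarith [mul_pos h pi, mul_pos h2 pk]
          · exact (hj i k l dj (-y) x z 0 (by omega) (by omega) (by omega) (by omega) le_rfl
              (by linear_combination -hs)).elim
      · rcases le_or_gt 0 z with h2 | h2
        · nlinarith [mul_pos h pi, mul_pos h1 pj, mul_nonneg h2 pk.le]
        · exact (hk i j l dk (-z) x y 0 (by omega) (by omega) (by omega) (by omega) le_rfl
            (by linear_combination -hs)).elim
  subst hx0
  have hy0 : y = 0 := by
    rcases lt_trichotomy y 0 with h | h | h
    · rcases le_or_gt 0 z with h2 | h2
      · exact (hj i k l dj (-y) 0 z 0 (by omega) (by omega) le_rfl h2 le_rfl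
          (by linear_combination -hs)).elim
      · nlinarith [mul_pos (neg_pos.2 h) pj, mul_pos (neg_pos.2 h2) pk]
    · exact h
    · rcases le_or_gt z 0 with h2 | h2
      · exact (hj i k l dj y 0 (-z) 0 (by omega) (by omega) le_rfl (by omega) le_rfl
          (by linear_combination hs)).elim
      · nlinarith [mul_pos h pj, mul_pos h2 pk]
  subst hy0
  refine ⟨rfl, rfl, ?_⟩
  have : z * n k = 0 := by linear_combination hs
  rcases mul_eq_zero.1 this with h | h
  · exact h
  · omega

namespace DualPair

variable {T : AddSubmonoid ℤ} {n : Fin 4 → ℤ} {u v : ℤ}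

theorem pattern_symm (h : DualPair T n u v) {t : Fin 4 → Fin 4 → Bool} (hp : HasPattern T n u t)
    {i j : Fin 4} (hij : i ≠ j) : Arrow T n v i j ↔ t j i = false := by
  rw [h.symm.arrow_iff hij, hp j i hij.symm]
  simp

/-- The missing arrows and caps force `a = 1` and `d = y`. Then `2 n 0 = (x + 1) n 1 + y n 2`, and
parity allows halving, which makes `n 0` redundant. -/
theorem lasso_false (h : DualPair T n u v) (hp : HasPattern T n u lassoPattern) : False := by
  have hq := fun {i j : Fin 4} (hij : i ≠ j) => h.pattern_symm hp hij
  have u03 : ¬ Arrow T n u 0 3 := mt (hp 0 3 (by decide)).1 (by decide)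
  have v20 : ¬ Arrow T n v 2 0 := mt (hq (by decide)).1 (by decide)
  have v01 : ¬ Arrow T n v 0 1 := mt (hq (by decide)).1 (by decide)
  obtain ⟨a, ha, h1, ca⟩ := h.row_one (i := 1) (j := 0) (k := 2) (l := 3) (by decide)
    (mt (hp _ _ (by decide)).1 (by decide)) (mt (hp _ _ (by decide)).1 (by decide))
  obtain ⟨b, hb, h2, cb⟩ := h.row_one (i := 2) (j := 3) (k := 0) (l := 1) (by decide)
    (mt (hp _ _ (by decide)).1 (by decide)) (mt (hp _ _ (by decide)).1 (by decide))
  obtain ⟨c, hc, h3, cc⟩ := h.row_one (i := 3) (j := 1) (k := 0) (l := 2) (by decide)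
    (mt (hp _ _ (by decide)).1 (by decide)) (mt (hp _ _ (by decide)).1 (by decide))
  obtain ⟨d, hd, k1, cd⟩ := h.symm.row_one (i := 1) (j := 2) (k := 0) (l := 3) (by decide)
    (mt (hq (by decide)).1 (by decide)) (mt (hq (by decide)).1 (by decide))
  obtain ⟨x, y, hx, hy, h0⟩ := h.row_two (i := 0) (j := 1) (k := 2) (l := 3) (by decide) u03
  obtain ⟨p, q, hp0, hq0, k0⟩ := h.symm.row_two (i := 0) (j := 2) (k := 3) (l := 1) (by decide) v01
  obtain ⟨s, r, hs, hr, k2⟩ := h.symm.row_two_of_arrow (i := 2) (j := 3) (k := 1) (l := 0)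
    (by decide) ((hq (by decide)).2 (by decide)) v20
  have hxc : x < c := by
    by_contra hn
    apply h.gen_sub_notMem 0 3 (by decide)
    rw [show n 0 - n 3 = (x - c) * n 1 + y * n 2 + 0 * n 3 by linear_combination h0 - h3]
    exact h.comb_mem (by omega) hy le_rfl _ _ _
  have hyd : y ≤ d := by
    by_contra hn
    apply u03
    rw [Arrow, show u + n 0 - n 3 = (x + r + 1) * n 1 + (y - d - 1) * n 2 + (s - 1) * n 3 by
      linear_combination h0 + k2 - k1]
    exact h.comb_mem (by omega) (by omega) (by omega) _ _ _
  have hpd : p < d := by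
    by_contra hn
    apply h.gen_sub_notMem 0 1 (by decide)
    rw [show n 0 - n 1 = (p - d) * n 2 + q * n 3 + 0 * n 3 by linear_combination k0 - k1]
    exact h.comb_mem (by omega) hq0 le_rfl _ _ _
  have hq1 : 1 ≤ q := by
    by_contra hn
    obtain rfl : q = 0 := by omega
    apply h.gen_sub_notMem 1 0 (by decide)
    rw [show n 1 - n 0 = (d - p) * n 2 by linear_combination k1 - k0]
    exact h.mul_mem (by omega) _
  have hrc : r ≤ c := by
    by_contra hn
    apply v20
    rw [Arrow, show v + n 2 - n 0 = (a - 1) * n 0 + (r - c - 1) * n 1 + (s + 1) * n 3 by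
      linear_combination k2 + h1 - h3]
    exact h.comb_mem (by omega) (by omega) (by omega) _ _ _
  have hqb : q ≤ b := by
    by_contra hn
    apply v01
    rw [Arrow, show v + n 0 - n 1 = (c - 1) * n 1 + (p + 1) * n 2 + (q - b - 1) * n 3 by
      linear_combination k0 + h3 - h2]
    exact h.comb_mem (by omega) (by omega) (by omega) _ _ _
  have hsb : s ≤ b := by
    by_contra hn
    apply h.right_notMem
    rw [show v = (r + c) * n 1 + 0 * n 2 + (s - b - 1) * n 3 by
      linear_combination k2 + h3 - h2]
    exact h.comb_mem (by omega) (by omega) (by omega) _ _ _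
  -- The preceding bounds serve to keep the coefficients of this relation within the caps.
  obtain ⟨e1, e2, e3⟩ := cc.eq_zero (i := 1) (j := 2) (k := 3) (l := 0) (by decide) cd cb
    (h.pos _) (h.pos _) (h.pos _) (x := r + x - c) (y := y - p - 1) (z := s - q + 1) (by omega)
    (by omega) (by omega) (by omega) (by omega) (by omega)
    (by linear_combination h3 - h0 + k0 - k2)
  have hrel : (a - 1) * n 0 = (b - q) * n 3 + (d - p - 1) * n 2 := by
    linear_combination h2 - h1 + k1 - k0
  have ha1 : a = 1 := by
    by_contra hn
    exact ca 2 3 1 (by decide) (a - 1) (d - p - 1) (b - q) 0 (by omega) (by omega) (by omega)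
      (by omega) le_rfl (by linear_combination hrel)
  subst ha1
  have hdy : d = y := by
    by_contra hn
    have : 0 < (d - p - 1) * n 2 := mul_pos (by omega) (h.pos _)
    have : 0 ≤ (b - q) * n 3 := mul_nonneg (by omega) (h.pos _).le
    linarith
  have hueven : Even u := by
    rw [show u = n 0 - n 1 by linear_combination h1]
    exact (h.odd 0).sub_odd (h.odd 1)
  have hdeven : Even d := by
    rw [← h.even_iff d 2, ← k1, h.symm.even_add_iff, h.odd_right_iff]
    exact hueven
  have hxy : ¬ Even (x + y) := by
    rw [← h.even_comb_iff x y 1 2, ← h0, h.even_add_iff]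
    exact Int.not_odd_iff_even.2 hueven
  rw [← hdy, Int.even_add] at hxy
  have hxo : Odd x := by
    rw [← Int.not_even_iff_odd]
    tauto
  obtain ⟨x', rfl⟩ := hxo
  obtain ⟨d', rfl⟩ := hdeven
  apply h.gen_sub_notMem 0 1 (by decide)
  rw [show n 0 - n 1 = x' * n 1 + d' * n 2 + 0 * n 3 by
    have : 2 * (n 0 - n 1) = 2 * (x' * n 1 + d' * n 2 + 0 * n 3) := by
      rw [← hdy] at h0
      linear_combination h0 - h1
    linarith]
  exact h.comb_mem (by omega) (by omega) le_rfl _ _ _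

/-- Capping forces `y = 1`, `p = b - x` and `q = c - 1`. Then `(d + 1) n 2 = (p + 1) n 1 + q n 3`
has even coefficients, and half of it violates the cap of `n 2`. -/
theorem path_false (h : DualPair T n u v) (hu : Odd u) (hp : HasPattern T n u pathPattern) :
    False := by
  have hv : Even v := h.odd_left_iff.1 hu
  have hq := fun {i j : Fin 4} (hij : i ≠ j) => h.pattern_symm hp hij
  have u03 : ¬ Arrow T n u 0 3 := mt (hp 0 3 (by decide)).1 (by decide)
  obtain ⟨b, hb, h3, cb⟩ := h.row_one (i := 3) (j := 1) (k := 0) (l := 2) (by decide)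
    (mt (hp _ _ (by decide)).1 (by decide)) (mt (hp _ _ (by decide)).1 (by decide))
  obtain ⟨c, hc, k0, cc⟩ := h.symm.row_one (i := 0) (j := 3) (k := 1) (l := 2) (by decide)
    (mt (hq (by decide)).1 (by decide)) (mt (hq (by decide)).1 (by decide))
  obtain ⟨d, hd, k1, cd⟩ := h.symm.row_one (i := 1) (j := 2) (k := 0) (l := 3) (by decide)
    (mt (hq (by decide)).1 (by decide)) (mt (hq (by decide)).1 (by decide))
  obtain ⟨x, y, hx, hy, h0⟩ := h.row_two (i := 0) (j := 1) (k := 2) (l := 3) (by decide) u03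
  obtain ⟨q, p, hq0, hp0, k2⟩ := h.symm.row_two_of_arrow (i := 2) (j := 3) (k := 1) (l := 0)
    (by decide) ((hq (by decide)).2 (by decide)) (mt (hq (by decide)).1 (by decide))
  have hxb : x < b := by
    by_contra hn
    apply h.gen_sub_notMem 0 3 (by decide)
    rw [show n 0 - n 3 = (x - b) * n 1 + y * n 2 + 0 * n 3 by linear_combination h0 - h3]
    exact h.comb_mem (by omega) hy le_rfl _ _ _
  have hqc : q < c := by
    by_contra hn
    apply h.gen_sub_notMem 2 0 (by decide)
    rw [show n 2 - n 0 = p * n 1 + (q - c) * n 3 + 0 * n 3 by linear_combination k2 - k0]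
    exact h.comb_mem (by omega) (by omega) le_rfl _ _ _
  have hy1 : 1 ≤ y := by
    by_contra hn
    obtain rfl : y = 0 := by omega
    apply h.gen_sub_notMem 3 0 (by decide)
    rw [show n 3 - n 0 = (b - x) * n 1 by linear_combination h3 - h0]
    exact h.mul_mem (by omega) _
  have hyd : y ≤ d := by
    by_contra hn
    apply u03
    rw [Arrow, show u + n 0 - n 3 = (x + p + 1) * n 1 + (y - d - 1) * n 2 + (q - 1) * n 3 by
      linear_combination h0 + k2 - k1]
    exact h.comb_mem (by omega) (by omega) (by omega) _ _ _
  have hrel : (b - x - p) * n 1 + (c - q - 1) * n 3 = (y - 1) * n 2 := by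
    linear_combination h0 - h3 - k0 + k2
  have hbxp : p ≤ b - x := by
    by_contra hn
    have hpos : 0 < (p + x - b) * n 1 := mul_pos (by omega) (h.pos _)
    have hnn : 0 ≤ (y - 1) * n 2 := mul_nonneg (by omega) (h.pos _).le
    rcases (show c - q - 1 = 0 ∨ 1 ≤ c - q - 1 by omega) with h4 | h4
    · rw [h4] at hrel
      linarith
    · exact cc 1 2 0 (by decide) (c - q - 1) (p + x - b) (y - 1) 0 h4 (by omega) (by omega)
        (by omega) le_rfl (by linear_combination hrel)
  have hy2 : y = 1 := by
    by_contra hn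
    exact cd 1 3 0 (by decide) (y - 1) (b - x - p) (c - q - 1) 0 (by omega) (by omega) (by omega)
      (by omega) le_rfl (by linear_combination -hrel)
  subst hy2
  have e1 : 0 ≤ (b - x - p) * n 1 := mul_nonneg (by omega) (h.pos _).le
  have e2 : 0 ≤ (c - q - 1) * n 3 := mul_nonneg (by omega) (h.pos _).le
  have e3 : p = b - x := by
    by_contra hn
    have : 0 < (b - x - p) * n 1 := mul_pos (by omega) (h.pos _)
    linarith
  have e4 : q = c - 1 := by
    by_contra hn
    have : 0 < (c - q - 1) * n 3 := mul_pos (by omega) (h.pos _)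
    linarith
  have hbe : Even b := by rwa [← h.even_iff b 1, ← h3, h.even_add_iff]
  have hxe : Even (x + 1) := by rwa [← h.even_comb_iff x 1 1 2, ← h0, h.even_add_iff]
  have hce : Odd c := by
    rw [← Int.not_even_iff_odd, ← h.even_iff c 3, ← k0, h.symm.even_add_iff]
    exact Int.not_odd_iff_even.2 hv
  have hde : Odd d := by
    rw [← Int.not_even_iff_odd, ← h.even_iff d 2, ← k1, h.symm.even_add_iff]
    exact Int.not_odd_iff_even.2 hv
  obtain ⟨b', rfl⟩ := hbe
  obtain ⟨x', hx'⟩ := hxe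
  obtain ⟨c', rfl⟩ := hce
  obtain ⟨d', rfl⟩ := hde
  obtain rfl : x = 2 * x' - 1 := by omega
  subst e3 e4
  exact cd 1 3 0 (by decide) (d' + 1) (b' - x' + 1) c' 0 (by omega) (by omega) (by omega)
    (by omega) le_rfl (by linarith)

/-- Rows `2` and `3` of `u` point at each other, so integer combinations of `n 2` and `n 3` obey
`comb_mem_or_sub`. It turns out that `v` is such a combination, although neither `v` nor `u - v` is
in `T`. -/
theorem square_false (h : DualPair T n u v) (hu : Odd u) (hp : HasPattern T n u squarePattern) :
    False := by
  have hq := fun {i j : Fin 4} (hij : i ≠ j) => h.pattern_symm hp hij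
  have u20 : ¬ Arrow T n u 2 0 := mt (hp _ _ (by decide)).1 (by decide)
  have u21 : ¬ Arrow T n u 2 1 := mt (hp _ _ (by decide)).1 (by decide)
  have u30 : ¬ Arrow T n u 3 0 := mt (hp _ _ (by decide)).1 (by decide)
  have u31 : ¬ Arrow T n u 3 1 := mt (hp _ _ (by decide)).1 (by decide)
  have u03 : ¬ Arrow T n u 0 3 := mt (hp 0 3 (by decide)).1 (by decide)
  have v01 : ¬ Arrow T n v 0 1 := mt (hq (by decide)).1 (by decide)
  have v10 : ¬ Arrow T n v 1 0 := mt (hq (by decide)).1 (by decide)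
  obtain ⟨b, hb, h2, -⟩ := h.row_one (i := 2) (j := 3) (k := 0) (l := 1) (by decide) u20 u21
  obtain ⟨c, hc, h3, -⟩ := h.row_one (i := 3) (j := 2) (k := 0) (l := 1) (by decide) u30 u31
  obtain ⟨d, hd, k2, -⟩ := h.symm.row_one (i := 2) (j := 1) (k := 0) (l := 3) (by decide)
    (mt (hq (by decide)).1 (by decide)) (mt (hq (by decide)).1 (by decide))
  obtain ⟨e, he, k3, ce⟩ := h.symm.row_one (i := 3) (j := 0) (k := 1) (l := 2) (by decide)
    (mt (hq (by decide)).1 (by decide)) (mt (hq (by decide)).1 (by decide))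
  obtain ⟨y, z, hy, hz, h0⟩ := h.row_of_single_swap (i := 2) (j := 3) (k := 0) (l := 1)
    (by decide) u20 u21 u30 u31 v01 v10
  have hz0 : z = 0 := h.coeff_eq_zero (k := 2) (l := 1) hz hy (z := 1) (by norm_num)
    (by rw [h0]; ring) u03
  subst hz0
  obtain ⟨p, q, hp0, hq0, k0⟩ := h.symm.row_two (i := 0) (j := 2) (k := 3) (l := 1) (by decide) v01
  have hyc : y < c := by
    by_contra hn
    apply h.gen_sub_notMem 0 3 (by decide)
    rw [show n 0 - n 3 = 1 * n 1 + (y - c) * n 2 + 0 * n 3 by linear_combination h0 - h3]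
    exact h.comb_mem (by omega) (by omega) le_rfl _ _ _
  have he1 : e = 1 := by
    by_contra hn
    exact ce 1 2 3 (by decide) (e - 1) (d - 1) (c - y - 1) 0 (by omega) (by omega) (by omega)
      (by omega) le_rfl (by linear_combination k2 - k3 - h0 + h3)
  subst he1
  have hbe : Even b := by rwa [← h.even_iff b 3, ← h2, h.even_add_iff]
  have hce : Even c := by rwa [← h.even_iff c 2, ← h3, h.even_add_iff]
  have hdouble : 2 * n 0 = p * n 2 + (q + 1) * n 3 := by linear_combination k0 - k3
  have hpq : Even (p + (q + 1)) := by
    rw [← h.even_comb_iff p (q + 1) 2 3, ← hdouble]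
    exact even_two_mul _
  obtain ⟨α, β, hαβ⟩ : ∃ α β : ℤ, v = α * n 2 + β * n 3 := by
    obtain ⟨b', rfl⟩ := hbe
    obtain ⟨c', rfl⟩ := hce
    rcases Int.even_or_odd' p with ⟨p', rfl | rfl⟩
    · obtain ⟨q', hq'⟩ : Even (q + 1) := by
        have := hpq.sub (even_two_mul p')
        simpa using this
      exact ⟨p', q' - 1, by rw [hq'] at hdouble; linarith⟩
    -- For odd `p` the relation `(c + 1) n 2 = (b + 1) n 3`, whose coefficients are odd, is added
    -- before halving.
    · obtain ⟨q', hq'⟩ : Even q := by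
        have := hpq.sub (even_two_mul (p' + 1))
        rwa [show 2 * p' + 1 + (q + 1) - 2 * (p' + 1) = q by ring] at this
      exact ⟨p' + c' + 1, q' - b' - 1, by rw [hq'] at hdouble; linarith⟩
  rcases h.comb_mem_or_sub (i := 2) (j := 3) (k := 0) (l := 1) (by decide) u20 u21 u30 u31 α β with
    hm | ⟨r, s, hr, hs, hrs⟩
  · exact h.right_notMem (hαβ ▸ hm)
  · apply h.left_sub_right_notMem
    rw [hαβ, hrs]
    exact add_mem (h.mul_mem hr _) (h.mul_mem hs _)

/-- Two short relations identify most coefficients. If `u` is even, half of `(a + 1) n 0 = (x + 1) n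
1 + y n 2` violates a cap; if `u` is odd, half of `(x + d) n 1 = (y + 3) n 2 + (q - 1) n 3` does, as
`x ≤ d`. -/
theorem linked_false (h : DualPair T n u v) (hp : HasPattern T n u linkedPattern) : False := by
  have hq := fun {i j : Fin 4} (hij : i ≠ j) => h.pattern_symm hp hij
  have u01 : Arrow T n u 0 1 := (hp _ _ (by decide)).2 (by decide)
  have u02 : Arrow T n u 0 2 := (hp _ _ (by decide)).2 (by decide)
  have u03 : ¬ Arrow T n u 0 3 := mt (hp 0 3 (by decide)).1 (by decide)
  have u20 : ¬ Arrow T n u 2 0 := mt (hp _ _ (by decide)).1 (by decide)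
  have u21 : Arrow T n u 2 1 := (hp _ _ (by decide)).2 (by decide)
  have v01 : ¬ Arrow T n v 0 1 := mt (hq (by decide)).1 (by decide)
  have v02 : Arrow T n v 0 2 := (hq (by decide)).2 (by decide)
  have v30 : Arrow T n v 3 0 := (hq (by decide)).2 (by decide)
  have v32 : ¬ Arrow T n v 3 2 := mt (hq (by decide)).1 (by decide)
  obtain ⟨a, ha, h1, ca⟩ := h.row_one (i := 1) (j := 0) (k := 2) (l := 3) (by decide)
    (mt (hp _ _ (by decide)).1 (by decide)) (mt (hp _ _ (by decide)).1 (by decide))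
  obtain ⟨b, hb, h3, cb⟩ := h.row_one (i := 3) (j := 2) (k := 0) (l := 1) (by decide)
    (mt (hp _ _ (by decide)).1 (by decide)) (mt (hp _ _ (by decide)).1 (by decide))
  obtain ⟨c, hc, k1, cc⟩ := h.symm.row_one (i := 1) (j := 3) (k := 0) (l := 2) (by decide)
    (mt (hq (by decide)).1 (by decide)) (mt (hq (by decide)).1 (by decide))
  obtain ⟨d, hd, k2, cd⟩ := h.symm.row_one (i := 2) (j := 1) (k := 0) (l := 3) (by decide)
    (mt (hq (by decide)).1 (by decide)) (mt (hq (by decide)).1 (by decide))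
  obtain ⟨x, y, hx, hy, h0⟩ := h.row_two_of_arrow (i := 0) (j := 1) (k := 2) (l := 3) (by decide)
    u01 u03
  obtain ⟨y', x', hy', hx', h0'⟩ := h.row_two_of_arrow (i := 0) (j := 2) (k := 1) (l := 3)
    (by decide) u02 u03
  obtain ⟨z, w, hz, hw, h2⟩ := h.row_two_of_arrow (i := 2) (j := 1) (k := 3) (l := 0) (by decide)
    u21 u20
  obtain ⟨p, q, hp0, hq0, k0⟩ := h.symm.row_two_of_arrow (i := 0) (j := 2) (k := 3) (l := 1)
    (by decide) v02 v01
  obtain ⟨r, s, hr, hs, k3⟩ := h.symm.row_two_of_arrow (i := 3) (j := 0) (k := 1) (l := 2)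
    (by decide) v30 v32
  have hyb : y < b := by
    by_contra hn
    apply h.gen_sub_notMem 0 3 (by decide)
    rw [show n 0 - n 3 = x * n 1 + (y - b) * n 2 + 0 * n 3 by linear_combination h0 - h3]
    exact h.comb_mem (by omega) (by omega) le_rfl _ _ _
  have hqc : q < c := by
    by_contra hn
    apply h.gen_sub_notMem 0 1 (by decide)
    rw [show n 0 - n 1 = p * n 2 + (q - c) * n 3 + 0 * n 3 by linear_combination k0 - k1]
    exact h.comb_mem (by omega) (by omega) le_rfl _ _ _
  have hpb : p ≤ b := by
    by_contra hn
    apply v01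
    rw [Arrow, show v + n 0 - n 1 = (z - 1) * n 1 + (p - b - 1) * n 2 + (q + w + 1) * n 3 by
      linear_combination k0 + h2 - h3]
    exact h.comb_mem (by omega) (by omega) (by omega) _ _ _
  have hzd : z ≤ d := by
    by_contra hn
    apply h.left_notMem
    rw [show u = (z - d - 1) * n 1 + 0 * n 2 + (w + c) * n 3 by linear_combination h2 + k1 - k2]
    exact h.comb_mem (by omega) (by omega) (by omega) _ _ _
  have hxd : x ≤ d := by
    by_contra hn
    apply u03
    rw [Arrow, show u + n 0 - n 3 = (x - d - 1) * n 1 + (y + 1) * n 2 + (c - 1) * n 3 by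
      linear_combination h0 + k1 - k2]
    exact h.comb_mem (by omega) (by omega) (by omega) _ _ _
  have hwc : w ≤ c := by
    by_contra hn
    apply u20
    rw [Arrow, show u + n 2 - n 0 = (r - 1) * n 0 + (z + s + 1) * n 1 + (w - c - 1) * n 3 by
      linear_combination h2 + k3 - k1]
    exact h.comb_mem (by omega) (by omega) (by omega) _ _ _
  obtain ⟨e1, e2, e3⟩ := cd.eq_zero (i := 1) (j := 2) (k := 3) (l := 0) (by decide) cb cc
    (h.pos _) (h.pos _) (h.pos _) (x := z - x + 1) (y := p - y - 1) (z := w + q - c) (by omega)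
    (by omega) (by omega) (by omega) (by omega) (by omega)
    (by linear_combination h0 - h2 + k1 - k0)
  have hsd : s < d := by
    by_contra hn
    apply h.gen_sub_notMem 3 2 (by decide)
    rw [show n 3 - n 2 = r * n 0 + (s - d) * n 1 + 0 * n 3 by linear_combination k3 - k2]
    exact h.comb_mem (by omega) (by omega) le_rfl _ _ _
  have hra : r ≤ a := by
    by_contra hn
    apply v32
    rw [Arrow, show v + n 3 - n 2 = (r - a - 1) * n 0 + (s + x' + 1) * n 1 + (y' - 1) * n 2 by
      linear_combination k3 + h0' - h1]
    exact h.comb_mem (by omega) (by omega) (by omega) _ _ _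
  obtain ⟨e4, e5, e6⟩ := ca.eq_zero (i := 0) (j := 1) (k := 2) (l := 3) (by decide) cd cb
    (h.pos _) (h.pos _) (h.pos _) (x := r - 1) (y := s + x - d) (z := y + 1 - b) (by omega)
    (by omega) (by omega) (by omega) (by omega) (by omega)
    (by linear_combination h3 - h0 + k2 - k3)
  obtain rfl : z = x - 1 := by omega
  obtain rfl : p = y + 1 := by omega
  obtain rfl : w = c - q := by omega
  obtain rfl : b = y + 1 := by omega
  rcases Int.even_or_odd u with hu | hu
  · have hao : Odd a := by
      rw [← Int.not_even_iff_odd, ← h.even_iff a 0, ← h1, h.even_add_iff]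
      exact Int.not_odd_iff_even.2 hu
    have hbo : Odd (y + 1) := by
      rw [← Int.not_even_iff_odd, ← h.even_iff (y + 1) 2, ← h3, h.even_add_iff]
      exact Int.not_odd_iff_even.2 hu
    have hxy : Odd (x + y) := by
      rw [← Int.not_even_iff_odd, ← h.even_comb_iff x y 1 2, ← h0, h.even_add_iff]
      exact Int.not_odd_iff_even.2 hu
    obtain ⟨a', rfl⟩ := hao
    obtain ⟨b', hb'⟩ := hbo
    obtain ⟨x'', hx''⟩ := hxy
    obtain rfl : y = 2 * b' := by omega
    obtain ⟨x', rfl⟩ : ∃ x', x = 2 * x' + 1 := ⟨x'' - b', by omega⟩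
    exact ca 1 2 3 (by decide) (a' + 1) (x' + 1) b' 0 (by omega) (by omega) (by omega)
      (by omega) le_rfl (by linarith)
  · have hbe : Even (y + 1) := by rwa [← h.even_iff (y + 1) 2, ← h3, h.even_add_iff]
    have hxy : Even (x + y) := by rwa [← h.even_comb_iff x y 1 2, ← h0, h.even_add_iff]
    have hv : ¬ Odd v := Int.not_odd_iff_even.2 (h.odd_left_iff.1 hu)
    have hdo : Odd d := by
      rwa [← Int.not_even_iff_odd, ← h.even_iff d 1, ← k2, h.symm.even_add_iff]
    have hpq : Odd (y + 1 + q) := by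
      rwa [← Int.not_even_iff_odd, ← h.even_comb_iff (y + 1) q 2 3, ← k0, h.symm.even_add_iff]
    obtain ⟨b', hb'⟩ := hbe
    obtain ⟨x'', hx''⟩ := hxy
    obtain ⟨d', rfl⟩ := hdo
    obtain ⟨q'', hq''⟩ := hpq
    obtain rfl : y = 2 * b' - 1 := by omega
    obtain ⟨x', rfl⟩ : ∃ x', x = 2 * x' + 1 := ⟨x'' - b', by omega⟩
    obtain ⟨q', rfl⟩ : ∃ q', q = 2 * q' + 1 := ⟨q'' - b', by omega⟩
    exact cd 2 3 0 (by decide) (x' + d' + 1) (b' + 1) q' 0 (by omega) (by omega) (by omega)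
      (by omega) le_rfl (by linarith)

/-- One of four rotated memberships which together show `2 * u ∉ T`: subtracting a generator from `2
* u` and adding `v + n i - u` would give `u + v ∈ T`. -/
theorem cycle_row (h : DualPair T n u v) (hp : HasPattern T n u cyclePattern) :
    v + n 1 - u ∈ T := by
  have hq := fun {i j : Fin 4} (hij : i ≠ j) => h.pattern_symm hp hij
  obtain ⟨a, ha, h0, ca⟩ := h.row_one (i := 0) (j := 1) (k := 2) (l := 3) (by decide)
    (mt (hp _ _ (by decide)).1 (by decide)) (mt (hp _ _ (by decide)).1 (by decide))
  obtain ⟨b, hb, h2, -⟩ := h.row_one (i := 2) (j := 3) (k := 0) (l := 1) (by decide)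
    (mt (hp _ _ (by decide)).1 (by decide)) (mt (hp _ _ (by decide)).1 (by decide))
  obtain ⟨x, y, hx, hy, k0⟩ := h.symm.row_two (i := 0) (j := 1) (k := 2) (l := 3) (by decide)
    (mt (hq (by decide)).1 (by decide))
  obtain ⟨z, w, hz, hw, k1⟩ := h.symm.row_two (i := 1) (j := 2) (k := 3) (l := 0) (by decide)
    (mt (hq (by decide)).1 (by decide))
  have hxa : x < a := by
    by_contra hn
    apply h.symm.left_sub_right_notMem
    rw [show v - u = (x - a) * n 1 + y * n 2 by linear_combination k0 - h0]
    exact add_mem (h.mul_mem (by omega) _) (h.mul_mem hy _)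
  have hyz : z < y := by
    by_contra hn
    exact ca 0 2 3 (by decide) (x + 1) 1 (z - y) w (by omega) (by omega) (by omega) (by omega) hw
      (by linear_combination k1 - k0)
  have hwb : b ≤ w := by
    by_contra! hn
    have hrel : (a - x - 1) * n 1 = (y - z - 1) * n 2 + (b - w) * n 3 := by
      linear_combination k0 - k1 - h0 + h2
    rcases (show a - x - 1 = 0 ∨ 1 ≤ a - x - 1 by omega) with h4 | h4
    · rw [h4] at hrel
      have : 0 ≤ (y - z - 1) * n 2 := mul_nonneg (by omega) (h.pos _).le
      have : 0 < (b - w) * n 3 := mul_pos (by omega) (h.pos _)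
      linarith
    · exact ca 0 2 3 (by decide) (a - x - 1) 0 (y - z - 1) (b - w) h4 (by omega) le_rfl (by omega)
        (by omega) (by linear_combination hrel)
  rw [show v + n 1 - u = (z + 1) * n 2 + (w - b) * n 3 by linear_combination k1 - h2]
  exact add_mem (h.mul_mem (by omega) _) (h.mul_mem (by omega) _)

end DualPair

/-! ### Finite classification of the possible digraphs -/

section Classification

/-- The orderings of the four indices. -/
def orderings : List (Fin 4 × Fin 4 × Fin 4 × Fin 4) :=
  [(0, 1, 2, 3), (0, 1, 3, 2), (0, 2, 1, 3), (0, 2, 3, 1),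
   (0, 3, 1, 2), (0, 3, 2, 1), (1, 0, 2, 3), (1, 0, 3, 2),
   (1, 2, 0, 3), (1, 2, 3, 0), (1, 3, 0, 2), (1, 3, 2, 0),
   (2, 0, 1, 3), (2, 0, 3, 1), (2, 1, 0, 3), (2, 1, 3, 0),
   (2, 3, 0, 1), (2, 3, 1, 0), (3, 0, 1, 2), (3, 0, 2, 1),
   (3, 1, 0, 2), (3, 1, 2, 0), (3, 2, 0, 1), (3, 2, 1, 0)]

theorem distinct_of_mem_orderings :
    ∀ s ∈ orderings, Distinct s.1 s.2.1 s.2.2.1 s.2.2.2 := by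
  decide +kernel

/-- The local configurations of arrows which cannot occur at the distinct indices `i, j, k, l`. -/
def forbidden (P : Fin 4 → Fin 4 → Bool) (i j k l : Fin 4) : Bool :=
  -- A negated entry is a missing arrow of `u`; a positive entry, read backwards, is a missing arrow
  -- of `v`.
  (!P i k && !P i l && P k i && P l i) ||
  (!P i k && !P i l && !P k i && !P k l) ||
  (P k i && P l i && P i k && P l k) ||
  (P k i && P l i && P k j && P l j) ||
  (!P i k && !P i l && !P j k && !P j l && P l k && P k l && !P k i && !P k j) ||
  (!P i l && !P k i && !P k l && P j i && P l i)

/-- Comparison of a digraph, with vertices in the order `i, j, k, l`, with a list of arrows. -/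
def agrees (P : Fin 4 → Fin 4 → Bool) (i j k l : Fin 4) (a b c d e f g h p q r s : Bool) : Bool :=
  (P i j == a) && (P i k == b) && (P i l == c) && (P j i == d) && (P j k == e) && (P j l == f) &&
  (P k i == g) && (P k j == h) && (P k l == p) && (P l i == q) && (P l j == r) && (P l k == s)

/-- The digraph is one of the eight remaining ones, after renumbering. -/
def isListed (P : Fin 4 → Fin 4 → Bool) (i j k l : Fin 4) : Bool :=
  -- In order: cycle, lasso, linked, path and square for `u`; then cycle, lasso and linked for `v`,
  -- whose arrows are the reversed non-arrows of `u`.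
  agrees P i j k l true false false false true false false false true true false false ||
  agrees P i j k l true true false true false false false false true false true false ||
  agrees P i j k l true true false true false false false true true false false true ||
  agrees P i j k l true true false true false true true false false false true false ||
  agrees P i j k l true true false true false true false false true false false true ||
  agrees (fun x y => !P y x) i j k l
    true false false false true false false false true true false false ||
  agrees (fun x y => !P y x) i j k l
    true true false true false false false false true false true false ||
  agrees (fun x y => !P y x) i j k l
    true true false true false false false true true false false true

/-- The entry with index `i`. -/
def entry (w x y z : Bool) (i : Fin 4) : Bool :=
  match i.val with
  | 0 => w
  | 1 => x
  | 2 => y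
  | _ => z

/-- The digraph with the given arrows. -/
def digraph (a b c d e f g h i j k l : Bool) (x y : Fin 4) : Bool :=
  entry (entry false a b c y) (entry d false e f y) (entry g h false i y) (entry j k l false y) x

/-- The row conditions say that `u` has an arrow out of every vertex, the column conditions say the
same for `v`. Row conditions are interleaved with the quantifiers so that evaluation drops a branch
once a row is empty. -/
theorem digraph_classification : ∀ a b c : Bool, (a || b || c) = true →
    ∀ d e f : Bool, (d || e || f) = true → ∀ g h i : Bool, (g || h || i) = true →
    ∀ j k l : Bool, (j || k || l) = true → (d && g && j) = false → (a && h && k) = false →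
    (b && e && l) = false → (c && f && i) = false →
    (orderings.any fun s => forbidden (digraph a b c d e f g h i j k l) s.1 s.2.1 s.2.2.1 s.2.2.2) =
      false → (orderings.any fun s =>
        isListed (digraph a b c d e f g h i j k l) s.1 s.2.1 s.2.2.1 s.2.2.2) = true := by
  decide +kernel

end Classification

/-! ### From the classification to the four-cycle -/

namespace DualPair

variable {T : AddSubmonoid ℤ} {n : Fin 4 → ℤ} {u v : ℤ}

theorem hasPattern_of_agrees {P : Fin 4 → Fin 4 → Bool}
    (hP : ∀ i j, i ≠ j → (Arrow T n u i j ↔ P i j = true)) {i j k l : Fin 4}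
    (hd : Distinct i j k l) {a b c d e f g h p q r s : Bool}
    (ha : agrees P i j k l a b c d e f g h p q r s = true) :
    HasPattern T (n ∘ ![i, j, k, l]) u
      ![![false, a, b, c], ![d, false, e, f], ![g, h, false, p], ![q, r, s, false]] := by
  simp only [agrees, Bool.and_eq_true, beq_iff_eq] at ha
  obtain ⟨⟨⟨⟨⟨⟨⟨⟨⟨⟨⟨rfl, rfl⟩, rfl⟩, rfl⟩, rfl⟩, rfl⟩, rfl⟩, rfl⟩, rfl⟩, rfl⟩, rfl⟩, rfl⟩ := ha
  obtain ⟨d1, d2, d3, d4, d5, d6⟩ := hd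
  intro x y hxy
  fin_cases x <;> fin_cases y <;> first | exact absurd rfl hxy | skip
  · exact hP i j d1
  · exact hP i k d2
  · exact hP i l d3
  · exact hP j i d1.symm
  · exact hP j k d4
  · exact hP j l d5
  · exact hP k i d2.symm
  · exact hP k j d4.symm
  · exact hP k l d6
  · exact hP l i d3.symm
  · exact hP l j d5.symm
  · exact hP l k d6.symm

theorem bijective_of_distinct {i j k l : Fin 4} (hd : Distinct i j k l) :
    Function.Bijective ![i, j, k, l] := by
  obtain ⟨d1, d2, d3, d4, d5, d6⟩ := hd
  refine Finite.injective_iff_bijective.1 fun x y hxy => ?_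
  fin_cases x <;> fin_cases y <;> simp_all

theorem exists_arrow (h : DualPair T n u v) {i j k l : Fin 4} (hd : Distinct i j k l) :
    Arrow T n u i j ∨ Arrow T n u i k ∨ Arrow T n u i l := by
  by_contra! hn
  obtain ⟨a, ha, hs, -⟩ := h.row_one hd hn.2.1 hn.2.2
  apply hn.1
  rw [Arrow, show u + n i - n j = (a - 1) * n j by linear_combination hs]
  exact h.mul_mem (by omega) _

theorem not_forbidden (h : DualPair T n u v) (hu : Odd u) {P : Fin 4 → Fin 4 → Bool}
    (hP : ∀ i j, i ≠ j → (Arrow T n u i j ↔ P i j = true)) {i j k l : Fin 4}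
    (hd : Distinct i j k l) : forbidden P i j k l = false := by
  obtain ⟨d1, d2, d3, d4, d5, d6⟩ := id hd
  have hv : Even v := h.odd_left_iff.1 hu
  have hu' : ∀ {x y}, x ≠ y → P x y = false → ¬ Arrow T n u x y := fun hxy hf ha => by
    simp [(hP _ _ hxy).1 ha] at hf
  have hv' : ∀ {x y}, x ≠ y → P y x = true → ¬ Arrow T n v x y := fun hxy ht =>
    (h.arrow_iff hxy.symm).1 ((hP _ _ hxy.symm).2 ht)
  rw [← Bool.not_eq_true]
  intro hf
  simp only [forbidden, Bool.or_eq_true, Bool.and_eq_true, Bool.not_eq_true'] at hf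
  rcases hf with ((((⟨⟨⟨h1, h2⟩, h3⟩, h4⟩ | ⟨⟨⟨h1, h2⟩, h3⟩, h4⟩) | ⟨⟨⟨h1, h2⟩, h3⟩, h4⟩) |
    ⟨⟨⟨h1, h2⟩, h3⟩, h4⟩) | ⟨⟨⟨⟨⟨⟨⟨h1, h2⟩, h3⟩, h4⟩, h5⟩, h6⟩, h7⟩, h8⟩) |
    ⟨⟨⟨⟨h1, h2⟩, h3⟩, h4⟩, h5⟩
  · exact h.not_single_single hd (hu' d2 h1) (hu' d3 h2) (hv' d2 h3) (hv' d3 h4)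
  · exact h.single_injective hd (hu' d2 h1) (hu' d3 h2) (hu' d2.symm h3) (hu' d6 h4)
  · exact h.symm.single_injective hd (hv' d2 h1) (hv' d3 h2) (hv' d2.symm h3) (hv' d6 h4)
  · exact h.symm.not_single_swap hv hd (hv' d2 h1) (hv' d3 h2) (hv' d4 h3) (hv' d5 h4)
  · exact h.not_single_swap_of_odd hu hd (hu' d2 h1) (hu' d3 h2) (hu' d4 h3) (hu' d5 h4)
      (hv' d6 h5) (hv' d6.symm h6) (hu' d2.symm h7) (hu' d4.symm h8)
  · exact h.not_chain hd (hu' d3 h1) (hu' d2.symm h2) (hu' d6 h3) (hv' d1 h4) (hv' d3 h5)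

/-- The Frobenius number is three times a number whose arrows form a four-cycle. -/
theorem two_mul_eq_of_cycle (h : DualPair T n u v) (hp : HasPattern T n u cyclePattern) :
    2 * u = v := by
  have hrot : ∀ (m : Fin 4 → ℤ), DualPair T m u v → HasPattern T m u cyclePattern →
      HasPattern T (m ∘ ![1, 2, 3, 0]) u cyclePattern := by
    intro m hm hmp x y hxy
    have := hmp (![1, 2, 3, 0] x) (![1, 2, 3, 0] y)
    fin_cases x <;> fin_cases y <;> first | exact absurd rfl hxy | exact this (by decide)
  have hbij : Function.Bijective (![1, 2, 3, 0] : Fin 4 → Fin 4) :=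
    bijective_of_distinct (by decide)
  have r1 := h.cycle_row hp
  have g2 := h.reindex hbij
  have p2 := hrot _ h hp
  have r2 := g2.cycle_row p2
  have g3 := g2.reindex hbij
  have p3 := hrot _ g2 p2
  have r3 := g3.cycle_row p3
  have g4 := g3.reindex hbij
  have p4 := hrot _ g3 p3
  have r4 := g4.cycle_row p4
  have hall : ∀ i, v + n i - u ∈ T := by
    intro i
    fin_cases i
    · exact r4
    · exact r1
    · exact r2
    · exact r3
  have h2u : 2 * u ∉ T := by
    intro hm
    rcases h.eq_zero_or_exists_sub_mem hm with h0 | ⟨i, hi⟩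
    · exact h.left_notMem (by rw [show u = 0 by omega]; exact T.zero_mem)
    · apply h.add_notMem
      convert add_mem hi (hall i) using 1
      ring
  by_contra hne
  have := h.dual _ h2u (fun h0 => h.left_notMem ?_) hne
  · apply h.symm.left_sub_right_notMem
    convert this using 1
    ring
  · rw [show u = 0 by omega]
    exact T.zero_mem

/-- The arrows of `u` form a four-cycle. -/
theorem exists_cycle (h : DualPair T n u v) (hu : Odd u) :
    ∃ σ : Fin 4 → Fin 4, Function.Bijective σ ∧ HasPattern T (n ∘ σ) u cyclePattern := by
  classical
  set P : Fin 4 → Fin 4 → Bool := fun i j => decide (Arrow T n u i j) with hPdef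
  have hP : ∀ i j, i ≠ j → (Arrow T n u i j ↔ P i j = true) := by simp [hPdef]
  have hP' : ∀ i j, i ≠ j → (Arrow T n v i j ↔ (fun x y => !P y x) i j = true) := by
    intro i j hij
    rw [h.symm.arrow_iff hij, hP j i hij.symm]
    simp
  have hdiag : ∀ i, P i i = false := by
    intro i
    simp [hPdef, Arrow, h.left_notMem]
  have htable : digraph (P 0 1) (P 0 2) (P 0 3) (P 1 0) (P 1 2) (P 1 3) (P 2 0) (P 2 1) (P 2 3)
      (P 3 0) (P 3 1) (P 3 2) = P := by
    funext i j
    fin_cases i <;> fin_cases j <;> first | rfl | exact (hdiag _).symm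
  have hrow : ∀ {i j k l : Fin 4}, Distinct i j k l → (P i j || P i k || P i l) = true := by
    intro i j k l hd
    obtain ⟨d1, d2, d3, d4, d5, d6⟩ := id hd
    have := h.exists_arrow hd
    rw [hP _ _ d1, hP _ _ d2, hP _ _ d3] at this
    simpa [or_assoc] using this
  have hcol : ∀ {i j k l : Fin 4}, Distinct i j k l → (P j i && P k i && P l i) = false := by
    intro i j k l hd
    obtain ⟨d1, d2, d3, d4, d5, d6⟩ := id hd
    have := h.symm.exists_arrow hd
    rw [hP' _ _ d1, hP' _ _ d2, hP' _ _ d3] at this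
    rw [← Bool.not_eq_true]
    intro hf
    simp only [Bool.and_eq_true] at hf
    simp [hf] at this
  have hforb : (orderings.any fun s => forbidden (digraph (P 0 1) (P 0 2) (P 0 3) (P 1 0) (P 1 2)
      (P 1 3) (P 2 0) (P 2 1) (P 2 3) (P 3 0) (P 3 1) (P 3 2)) s.1 s.2.1 s.2.2.1 s.2.2.2) =
      false := by
    rw [htable, List.any_eq_false]
    intro s hs
    rw [h.not_forbidden hu hP (distinct_of_mem_orderings s hs)]
    simp
  have hlist := digraph_classification (P 0 1) (P 0 2) (P 0 3) (hrow (by decide))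
    (P 1 0) (P 1 2) (P 1 3) (hrow (by decide)) (P 2 0) (P 2 1) (P 2 3) (hrow (by decide))
    (P 3 0) (P 3 1) (P 3 2) (hrow (by decide)) (hcol (by decide)) (hcol (by decide))
    (hcol (by decide)) (hcol (by decide)) hforb
  rw [htable, List.any_eq_true] at hlist
  obtain ⟨s, hs, hsl⟩ := hlist
  have hd := distinct_of_mem_orderings s hs
  have hbij := bijective_of_distinct hd
  have g := h.reindex hbij
  simp only [isListed, Bool.or_eq_true] at hsl
  rcases hsl with ((((((hl | hl) | hl) | hl) | hl) | hl) | hl) | hl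
  · exact ⟨_, hbij, hasPattern_of_agrees hP hd hl⟩
  · exact (g.lasso_false (hasPattern_of_agrees hP hd hl)).elim
  · exact (g.linked_false (hasPattern_of_agrees hP hd hl)).elim
  · exact (g.path_false hu (hasPattern_of_agrees hP hd hl)).elim
  · exact (g.square_false hu (hasPattern_of_agrees hP hd hl)).elim
  -- A four-cycle for `v` would give `u = 2 * v`, but `u` is odd.
  · have := g.symm.two_mul_eq_of_cycle (hasPattern_of_agrees hP' hd hl)
    exact ((Int.not_even_iff_odd.2 hu) (this ▸ even_two_mul v)).elim
  · exact (g.symm.lasso_false (hasPattern_of_agrees hP' hd hl)).elim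
  · exact (g.symm.linked_false (hasPattern_of_agrees hP' hd hl)).elim

end DualPair

/-! ### The converse: recovering `α` from the semigroup -/

section Converse

variable {S : AddSubmonoid ℕ} {n : Fin 4 → ℕ}

theorem IsMinimalSystemOfGenerators.mem (h : IsMinimalSystemOfGenerators n S) (i : Fin 4) :
    n i ∈ S :=
  h.1 ▸ AddSubmonoid.subset_closure (Set.mem_range_self i)

/-- In `n i = n j + ∑ c m * n m` a positive `c i` makes the right side too large; if `c i = 0`, then
`n i` is generated by the others. -/
theorem IsMinimalSystemOfGenerators.sub_notMem (h : IsMinimalSystemOfGenerators n S)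
    (hpos : ∀ i, 0 < n i) {i j : Fin 4} (hij : i ≠ j) : (n i : ℤ) - n j ∉ intElements S := by
  intro hm
  rw [← h.1, mem_intElements_closure_iff] at hm
  obtain ⟨c, hc⟩ := hm
  have hsum : n i = n j + ∑ m, c m * n m := by
    rw [Fin.sum_univ_four]
    zify
    linear_combination hc
  have hci : c i = 0 := by
    by_contra hne
    have h1 : c i * n i ≤ ∑ m, c m * n m :=
      Finset.single_le_sum (f := fun m => c m * n m) (fun _ _ => Nat.zero_le _)
        (Finset.mem_univ i)
    have h2 : n i ≤ c i * n i := Nat.le_mul_of_pos_left _ (Nat.pos_of_ne_zero hne)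
    have := hpos j
    omega
  apply h.2 i
  rw [hsum]
  refine add_mem (AddSubmonoid.subset_closure ⟨j, hij.symm, rfl⟩) (sum_mem fun m _ => ?_)
  by_cases hmi : m = i
  · subst hmi
    rw [hci, zero_mul]
    exact zero_mem _
  · rw [← smul_eq_mul]
    exact nsmul_mem (AddSubmonoid.subset_closure (Set.mem_image_of_mem n hmi)) _

theorem IsNumericalSemigroup.isUnit_of_dvd (hS : IsNumericalSemigroup S)
    (h : AddSubmonoid.closure (Set.range n) = S) {d : ℤ} (hd : ∀ i, d ∣ (n i : ℤ)) : IsUnit d := by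
  have hdvd : ∀ x ∈ intElements S, d ∣ x := by
    intro x hx
    rw [← h, mem_intElements_closure_iff] at hx
    obtain ⟨c, rfl⟩ := hx
    exact dvd_add (dvd_add (dvd_add ((hd 0).mul_left _) ((hd 1).mul_left _)) ((hd 2).mul_left _))
      ((hd 3).mul_left _)
  have hlarge : ∀ x : ℤ, frobeniusInt S < x → x ∈ intElements S := by
    intro x hx
    by_contra hn
    exact absurd ((isGreatest_frobeniusInt S hS).2 hn) (not_le.2 hx)
  have h1 := hdvd _ (hlarge (frobeniusInt S + 1) (by omega))
  have h2 := hdvd _ (hlarge (frobeniusInt S + 2) (by omega))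
  refine isUnit_of_dvd_one ?_
  have := dvd_sub h2 h1
  rwa [show frobeniusInt S + 2 - (frobeniusInt S + 1) = 1 by ring] at this

theorem IsAlmostSymmetric.exists_dualPair (hS : IsAlmostSymmetric S) (ht : semigroupType S = 3)
    (h : IsMinimalSystemOfGenerators n S) (hodd : ∀ i, Odd (n i)) :
    ∃ u v : ℤ, Odd u ∧ DualPair (intSubmonoid S) (fun i => (n i : ℤ)) u v := by
  obtain ⟨u, v, hF, hu, hv, huv, hdual⟩ := hS.exists_pair ht
  have hpos : ∀ i, 0 < n i := fun i => (hodd i).pos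
  have hpair : DualPair (intSubmonoid S) (fun i => (n i : ℤ)) u v := by
    refine ⟨fun i => by exact_mod_cast hpos i, fun i => by exact_mod_cast hodd i,
      fun i => natCast_mem_intElements.2 (h.mem i), fun x hx => ?_,
      fun i j hij => h.sub_notMem hpos hij, hu.1, hv.1, ?_,
      fun i => hu.2 _ (h.mem i) (hpos i).ne', fun i => hv.2 _ (h.mem i) (hpos i).ne', hdual, huv⟩
    · rw [mem_intSubmonoid, ← h.1, mem_intElements_closure_iff] at hx
      obtain ⟨c, rfl⟩ := hx
      exact ⟨fun i => c i, fun i => Int.natCast_nonneg _, by rw [Fin.sum_univ_four]⟩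
    · rw [← hF]
      exact (isGreatest_frobeniusInt S hS.1).1
  -- Exactly one of the two numbers is odd, and it is taken as the first.
  rcases Int.even_or_odd u with he | ho
  · exact ⟨v, u, hpair.odd_right_iff.2 he, hpair.symm⟩
  · exact ⟨u, v, ho, hpair⟩

/-- The coefficients are even because `u + m i` is even and `m j` is odd; this makes `α i = a i + 1`
odd. -/
theorem DualPair.exists_cyclicRelations {T : AddSubmonoid ℤ} {m : Fin 4 → ℤ} {u v : ℤ}
    (h : DualPair T m u v) (hu : Odd u) (hp : HasPattern T m u cyclePattern) :
    ∃ a : Fin 4 → ℤ, (∀ i, Even (a i)) ∧ CyclicRelations a m u := by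
  obtain ⟨a, ha, h0, -⟩ := h.row_one (i := 0) (j := 1) (k := 2) (l := 3) (by decide)
    (mt (hp _ _ (by decide)).1 (by decide)) (mt (hp _ _ (by decide)).1 (by decide))
  obtain ⟨b, hb, h1, -⟩ := h.row_one (i := 1) (j := 2) (k := 0) (l := 3) (by decide)
    (mt (hp _ _ (by decide)).1 (by decide)) (mt (hp _ _ (by decide)).1 (by decide))
  obtain ⟨c, hc, h2, -⟩ := h.row_one (i := 2) (j := 3) (k := 0) (l := 1) (by decide)
    (mt (hp _ _ (by decide)).1 (by decide)) (mt (hp _ _ (by decide)).1 (by decide))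
  obtain ⟨d, hd, h3, -⟩ := h.row_one (i := 3) (j := 0) (k := 1) (l := 2) (by decide)
    (mt (hp _ _ (by decide)).1 (by decide)) (mt (hp _ _ (by decide)).1 (by decide))
  have heven : ∀ {x : ℤ} {i j : Fin 4}, u + m i = x * m j → Even x := by
    intro x i j he
    rwa [← h.even_iff x j, ← he, h.even_add_iff]
  refine ⟨![d, a, b, c], fun i => ?_, ⟨fun i => ?_, h0, h1, h2, h3⟩⟩
  · fin_cases i
    · exact heven h3
    · exact heven h0
    · exact heven h1
    · exact heven h2
  · fin_cases i <;> assumption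

/-- Cyclically related positive numbers with greatest common divisor one, for which neither `f` nor
`2 * f` belongs to the semigroup, are the standard ones. -/
theorem CyclicRelations.eq_standard {a m : Fin 4 → ℤ} {f : ℤ} (h : CyclicRelations a m f)
    {T : AddSubmonoid ℤ} (hT : ∀ i, m i ∈ T) (hf : f ∉ T) (hf2 : 2 * f ∉ T) (hpos : ∀ i, 0 < m i)
    (hgcd : ∀ d : ℤ, (∀ i, d ∣ m i) → IsUnit d) :
    m 0 = a 1 * a 2 * (a 3 + 1) + a 1 + 1 ∧ m 1 = a 2 * a 3 * (a 0 + 1) + a 2 + 1 ∧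
      m 2 = a 3 * a 0 * (a 1 + 1) + a 3 + 1 ∧ m 3 = a 0 * a 1 * (a 2 + 1) + a 0 + 1 := by
  have hdvd : ∀ {b l : Fin 4 → ℤ}, CyclicRelations b l f → (∀ i, l i ∈ T) →
      b 1 * b 2 * (b 3 + 1) + b 1 + 1 ∣ l 0 := fun hb hl =>
    dvd_of_isConsequence fun x hx => hb.isConsequence_of_notMem hl hf hf2 hx
  have g1 := h.rotate
  have g2 := g1.rotate
  have g3 := g2.rotate
  have hf0 : f ≠ 0 := fun h0 => hf (h0 ▸ T.zero_mem)
  have hstd : ∀ {b l : Fin 4 → ℤ}, CyclicRelations b l f →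
      0 < b 1 * b 2 * (b 3 + 1) + b 1 + 1 := by
    intro b l hb
    have p1 := hb.pos 1
    have p2 := hb.pos 2
    have p3 := hb.pos 3
    have : 0 ≤ b 1 * b 2 * (b 3 + 1) := by positivity
    omega
  obtain ⟨k, hk⟩ := hdvd h hT
  -- By `mul_eq` the quotient times `a 0 * a 1 * a 2 * a 3 - 1` equals `f`; both quantities are
  -- invariant under rotation, so all four generators have the same quotient `k`.
  have hkmul : ∀ {b l : Fin 4 → ℤ}, CyclicRelations b l f → (∀ i, l i ∈ T) →
      b 0 * b 1 * b 2 * b 3 = a 0 * a 1 * a 2 * a 3 →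
      l 0 = (b 1 * b 2 * (b 3 + 1) + b 1 + 1) * k := by
    intro b l hb hl hprod
    obtain ⟨k', hk'⟩ := hdvd hb hl
    have e1 := h.mul_eq
    have e2 := hb.mul_eq
    rw [hprod] at e2
    rw [hk] at e1
    rw [hk'] at e2
    have f1 : (a 0 * a 1 * a 2 * a 3 - 1) * k = f := by
      refine mul_right_cancel₀ (hstd h).ne' ?_
      linear_combination e1
    have f2 : (a 0 * a 1 * a 2 * a 3 - 1) * k' = f := by
      refine mul_right_cancel₀ (hstd hb).ne' ?_
      linear_combination e2
    have hne : a 0 * a 1 * a 2 * a 3 - 1 ≠ 0 := by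
      intro h0
      rw [h0, zero_mul] at f1
      exact hf0 f1.symm
    rw [hk', mul_left_cancel₀ hne (f2.trans f1.symm)]
  have m1 := hkmul g1 (fun i => hT _) (by simp only [Fin.reduceAdd, zero_add]; ring)
  have m2 := hkmul g2 (fun i => hT _) (by simp only [Fin.reduceAdd, zero_add]; ring)
  have m3 := hkmul g3 (fun i => hT _) (by simp only [Fin.reduceAdd, zero_add]; ring)
  have m1' : m 1 = (a 2 * a 3 * (a 0 + 1) + a 2 + 1) * k := m1
  have m2' : m 2 = (a 3 * a 0 * (a 1 + 1) + a 3 + 1) * k := m2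
  have m3' : m 3 = (a 0 * a 1 * (a 2 + 1) + a 0 + 1) * k := m3
  have hunit : IsUnit k := by
    refine hgcd k fun i => ?_
    fin_cases i
    · exact ⟨_, hk.trans (mul_comm _ _)⟩
    · exact ⟨_, m1'.trans (mul_comm _ _)⟩
    · exact ⟨_, m2'.trans (mul_comm _ _)⟩
    · exact ⟨_, m3'.trans (mul_comm _ _)⟩
  have hk1 : k = 1 := by
    rcases Int.isUnit_iff.1 hunit with h1 | h1
    · exact h1
    · have := hpos 0
      have := hstd h
      rw [hk, h1] at *
      linarith
  rw [hk1, mul_one] at hk m1' m2' m3'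
  exact ⟨hk, m1', m2', m3'⟩

theorem exists_gens_of_isAlmostSymmetric (hS : IsAlmostSymmetric S) (ht : semigroupType S = 3)
    (h : IsMinimalSystemOfGenerators n S) (hodd : ∀ i, Odd (n i)) :
    ∃ α : Fin 4 → ℕ, (∀ i, Odd (α i) ∧ 1 < α i) ∧ Finset.univ.gcd (gens α) = 1 ∧
      ∃ σ : Equiv.Perm (Fin 4), ∀ i, n (σ i) = gens α i := by
  obtain ⟨u, v, hu, hpair⟩ := hS.exists_dualPair ht h hodd
  obtain ⟨σ, hσ, hp⟩ := hpair.exists_cycle hu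
  have g := hpair.reindex hσ
  obtain ⟨a, ha, hcyc⟩ := g.exists_cyclicRelations hu hp
  have hgcd : ∀ d : ℤ, (∀ i, d ∣ (n (σ i) : ℤ)) → IsUnit d := fun d hd =>
    hS.1.isUnit_of_dvd h.1 fun i => by
      obtain ⟨j, rfl⟩ := hσ.surjective i
      exact hd j
  obtain ⟨e0, e1, e2, e3⟩ := hcyc.eq_standard g.gen_mem g.left_notMem
    (by rw [g.two_mul_eq_of_cycle hp]; exact g.right_notMem) g.pos hgcd
  have hα : ∀ i, ((a i + 1).toNat : ℤ) = a i + 1 := fun i =>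
    Int.toNat_of_nonneg (by linarith [hcyc.pos i])
  have hα1 : ∀ i, 1 < (a i + 1).toNat := fun i => by
    have := hcyc.pos i
    omega
  have hgens : ∀ i, n (σ i) = gens (fun i => (a i + 1).toNat) i := by
    obtain ⟨g0, g1, g2, g3⟩ := gens_cast (α := fun i => (a i + 1).toNat) hα1
    simp only [hα, add_sub_cancel_right] at g0 g1 g2 g3
    intro i
    refine Nat.cast_injective (R := ℤ) ?_
    fin_cases i
    · exact e0.trans g0.symm
    · exact e1.trans g1.symm
    · exact e2.trans g2.symm
    · exact e3.trans g3.symm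
  refine ⟨fun i => (a i + 1).toNat, fun i => ⟨?_, hα1 i⟩, ?_, Equiv.ofBijective σ hσ, hgens⟩
  · have : Odd (((a i + 1).toNat : ℕ) : ℤ) := hα i ▸ (ha i).add_one
    exact_mod_cast this
  · have := hgcd (Finset.univ.gcd (gens fun i => (a i + 1).toNat) : ℕ) fun i => by
      rw [hgens i]
      exact_mod_cast Finset.gcd_dvd (Finset.mem_univ i)
    simpa using Int.isUnit_iff_natAbs_eq.1 this

end Converse

theorem theorem5p7 :
    (∀ α : Fin 4 → ℕ, (∀ i, Odd (α i) ∧ 1 < α i) →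
      Finset.univ.gcd (gens α) = 1 →
        IsAlmostSymmetric (AddSubmonoid.closure (Set.range (gens α))) ∧
        semigroupType (AddSubmonoid.closure (Set.range (gens α))) = 3 ∧
        (∀ i, Odd (gens α i)) ∧
        IsMinimalSystemOfGenerators (gens α) (AddSubmonoid.closure (Set.range (gens α)))) ∧
    (∀ (S : AddSubmonoid ℕ) (n : Fin 4 → ℕ),
      IsMinimalSystemOfGenerators n S → (∀ i, Odd (n i)) →
      IsAlmostSymmetric S → semigroupType S = 3 →
        ∃ α : Fin 4 → ℕ, (∀ i, Odd (α i) ∧ 1 < α i) ∧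
          Finset.univ.gcd (gens α) = 1 ∧
          ∃ σ : Equiv.Perm (Fin 4), ∀ i, n (σ i) = gens α i) := by
  refine ⟨fun α hα hgcd => ?_, fun S n h hodd hS ht =>
    exists_gens_of_isAlmostSymmetric hS ht h hodd⟩
  have hα1 : ∀ i, 1 < α i := fun i => (hα i).2
  obtain ⟨hS, ht⟩ := isAlmostSymmetric_gens hα1 hgcd
  exact ⟨hS, ht, odd_gens hα, rfl, gens_notMem_closure hα1 hgcd⟩
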